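/- Let $I\subseteq\mathbb R$ be an open interval and let $g:I\to\mathbb R$ be a smooth function that is nonlinear, i.e. not of the form $g(u)=au+b$ on $I$ with constants $a,b$. Consider the Klein–Gordon equation $u_{tx}=g(u)$ for functions $u(t,x)$ with values in $I$, and write $u_k=\partial_x^k u$. For $q\ge 1$ and an open set $V\subseteq\mathbb R\times\mathbb R^q$, a conservation law of pure $x$-derivative form of order $q$ over $V$ is a pair of smooth functions $P^t(x,u,u_1,\dots,u_q)$, $P^x(x,u,u_1,\dots,u_q)$, defined for $u\in I$ and $(x,u_1,\dots,u_q)\in V$, such that (1) $D_tP^t+D_xP^x=0$ holds on every smooth solution $u(t,x)$ of the equation, on any open set of the $(t,x)$-plane, whose jets $(x,u,u_1,\dots,u_q)$ stay in that domain; (2) the multiplier $\Lambda=\sum_{k=1}^{q}(-D_x)^{k-1}\,\partial P^t/\partial u_k$, where $D_x=\partial_x+u_1\partial_u+u_2\partial_{u_1}+\cdots$, has order exactly $2q-1$, i.e. $\partial\Lambda/\partial u_{2q-1}$ is not identically zero and $\Lambda$ depends on no $u_m$ with $m>2q-1$. If the equation $u_{tx}=g(u)$ admits a conservation law of pure $x$-derivative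 form of order $2$ over some open set $V$, then for every $q>1$ it admits a conservation law of pure $x$-derivative form of order $q$ over $V=\mathbb R\times\mathbb R^q$. In particular it is integrable in the sense of having infinitely many such conservation laws, of arbitrarily high order. -/

import Mathlib

open scoped ContDiff

noncomputable section

namespace KleinGordon

/-- A differential function of `x`, `u` and the `x`-derivatives of `u`: here `F x w` is the value at
the jet with base coordinate `x`, with `w 0 = u`, `w 1 = u_x`, `w 2 = u_xx`, and so on. -/
abbrev DiffFun : Type := ℝ → (ℕ → ℝ) → ℝ

/-- The partial derivative with respect to the jet coordinate `u_k = ∂ₓᵏ u`. -/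
def jetDeriv (k : ℕ) (F : DiffFun) : DiffFun := fun x w =>
  deriv (fun s => F x (Function.update w k s)) (w k)

/-- The total `x`-derivative `D_x = ∂_x + u_x ∂_u + u_xx ∂_{u_x} + ⋯`
(a finite sum, for a function of finitely many jet coordinates). -/
def totalDx (F : DiffFun) : DiffFun := fun x w =>
  deriv (fun y => F y w) x + ∑ᶠ k : ℕ, w (k + 1) * jetDeriv k F x w

/-- A function of `(x, u, u_x, …, ∂ₓ^q u)`, seen as a differential function. -/
def toDiffFun {q : ℕ} (P : ℝ × (Fin (q + 1) → ℝ) → ℝ) : DiffFun := fun x w =>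
  P (x, fun i => w i)

/-- The restricted Euler operator
`∂/∂u_x - D_x ∂/∂u_xx + ⋯ + (-D_x)^(q-1) ∂/∂(∂ₓ^q u)`, applied to a density
`P(x, u, …, ∂ₓ^q u)`. For a conserved density `P` it is the multiplier of the conservation law. -/
def multiplier {q : ℕ} (P : ℝ × (Fin (q + 1) → ℝ) → ℝ) : DiffFun := fun x w =>
  ∑ k ∈ Finset.range q, (fun F : DiffFun => -totalDx F)^[k] (jetDeriv (k + 1) (toDiffFun P)) x w

/-- The jets `(x, u, u_x, …, ∂ₓ^q u)` with `u ∈ I` and `(x, u_x, …, ∂ₓ^q u) ∈ V`. -/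
def jetDomain {q : ℕ} (I : Set ℝ) (V : Set (ℝ × (Fin q → ℝ))) : Set (ℝ × (Fin (q + 1) → ℝ)) :=
  {z | z.2 0 ∈ I ∧ (z.1, fun i : Fin q => z.2 i.succ) ∈ V}

/-- `F` has order exactly `p` over the jets that lie above `D`: it depends on `∂ₓᵖ u`
and on no higher `x`-derivative of `u`. -/
def HasOrderOn {q : ℕ} (D : Set (ℝ × (Fin (q + 1) → ℝ))) (F : DiffFun) (p : ℕ) : Prop :=
  (∃ x w, (x, fun i : Fin (q + 1) => w i) ∈ D ∧ jetDeriv p F x w ≠ 0) ∧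
    ∀ m, p < m → ∀ x w, (x, fun i : Fin (q + 1) => w i) ∈ D → jetDeriv m F x w = 0

/-- `u(t, x)` is a smooth solution of `u_tx = g(u)` on the open set `Ω` of the `(t, x)`-plane,
with values in `I`. -/
structure IsSolutionOn (g : ℝ → ℝ) (I : Set ℝ) (Ω : Set (ℝ × ℝ)) (u : ℝ × ℝ → ℝ) : Prop where
  isOpen : IsOpen Ω
  contDiffOn : ContDiffOn ℝ ∞ u Ω
  mapsTo : Set.MapsTo u Ω I
  eqn : ∀ t x, (t, x) ∈ Ω → deriv (fun s => deriv (fun y => u (s, y)) x) t = g (u (t, x))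

/-- The jet `(x, u, u_x, …, ∂ₓ^q u)` of the function `u` at the point `(t, x)`. -/
def xJet (q : ℕ) (u : ℝ × ℝ → ℝ) (t x : ℝ) : ℝ × (Fin (q + 1) → ℝ) :=
  (x, fun i => iteratedDeriv i (fun y => u (t, y)) x)

/-- `(Pt, Px)` is a conservation law of order `q` of `u_tx = g(u)`, `u ∈ I`, whose densities
are smooth functions of `(x, u, u_x, …, ∂ₓ^q u)` defined for `u ∈ I` and
`(x, u_x, …, ∂ₓ^q u) ∈ V`. -/
structure IsConservationLaw (g : ℝ → ℝ) (I : Set ℝ) (q : ℕ) (V : Set (ℝ × (Fin q → ℝ)))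
    (Pt Px : ℝ × (Fin (q + 1) → ℝ) → ℝ) : Prop where
  contDiffOn_Pt : ContDiffOn ℝ ∞ Pt (jetDomain I V)
  contDiffOn_Px : ContDiffOn ℝ ∞ Px (jetDomain I V)
  /-- `D_t Pt + D_x Px = 0` on all solutions `u(t, x)`. -/
  conserved : ∀ (Ω : Set (ℝ × ℝ)) (u : ℝ × ℝ → ℝ), IsSolutionOn g I Ω u →
    (∀ t x, (t, x) ∈ Ω → xJet q u t x ∈ jetDomain I V) →
    ∀ t x, (t, x) ∈ Ω →
      deriv (fun s => Pt (xJet q u s x)) t + deriv (fun y => Px (xJet q u t y)) x = 0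
  /-- The law is nontrivial of order exactly `q`: its multiplier has order `2q - 1`. -/
  order : ∃ p, p + 1 = 2 * q ∧ HasOrderOn (jetDomain I V) (multiplier Pt) p

end KleinGordon

end

/-! The condition `g'' = c g`, with `c` constant, is the pivot. It is forced by one law of order two
(`IsConservationLaw.exists_deriv_deriv_eq`), and it gives laws of every order `q > 1`
(`exists_isConservationLaw`).

Sufficiency. If `g'' = c g`, the `t`-derivative of a polynomial in `u_x, u_xx, …` has the form `A
g(u) + B g'(u)` with polynomial `A, B`, so the problem becomes algebra in a polynomial ring. The
Riccati equation with parameter `λ` behind the Bäcklund transformation has a formal solution `∑ yₙ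
λ⁻ⁿ` whose `t`-evolution is explicit (`evol_riccatiSeries`), and this makes every `u_x yₙ₊₁` with `n
≠ 0` a conserved density (`evol_riccati_density`). Give `∂ₓᵏ u` weight `k`. Then `u_x y_{2q-1}` has
weight `2q`, and integration by parts brings it down to order `q` (`exists_reduction`). The order
does not drop further, because the quadratic part is not a total derivative: it is detected by
evaluation at a superposition of `eˣ` and `e⁻ˣ`, where total derivatives vanish (`planeWave_totD`,
`planeWave_reduced`).

Necessity. Write `p = u_x`, `r = u_xx`, `P = Pt`, `Q = Px`. The conservation identity is tested on
similarity solutions `W(t (x + a))`, which pass through a given 2-jet with almost arbitrary `u_t = ρ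
p` (`exists_similarity_solution`). The identity is polynomial in `ρ`, and its coefficients give
determining equations (`IsConservationLaw.determining`): `P_u = 0`, `Q_r = 0` where `g ≠ 0`, and
`P_p g + P_r p g' + Q_x + p Q_u + r Q_p = 0`. Differentiating to eliminate `Q`
(`differential_consequences`) gives either `g' = k g` or `3 P_rr g'' = K g`, where `k`, `P_rr`, `K`
do not depend on `u`. Order exactly two means that `P_rr` is not identically zero, so both cases
give `g'' = c g`. -/

noncomputable section

namespace KleinGordon

open MvPolynomial

/-! ### Differential polynomials and their evolution when `g'' = c g` -/

/-- Differential polynomials in `u_x, u_xx, …`; the variable `X k` stands for `∂ₓ^(k+1) u`. -/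
abbrev DPoly : Type := MvPolynomial ℕ ℝ

/-- The total `x`-derivative on differential polynomials. -/
def totD : Derivation ℝ DPoly DPoly := mkDerivation ℝ fun k => X (k + 1)

@[simp] lemma totD_X (k : ℕ) : totD (X k) = X (k + 1) := mkDerivation_X _ _ _

/-- The total `x`-derivative of `F.1 * g(u) + F.2 * g'(u)`, when `g'' = c * g`. -/
def fluxD (c : ℝ) (F : DPoly × DPoly) : DPoly × DPoly :=
  (totD F.1 + c • (X 0 * F.2), totD F.2 + X 0 * F.1)

/-- The coefficients of `g(u)` and `g'(u)` in `∂ₜ ∂ₓ^(k+1) u = ∂ₓ^k g(u)`. -/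
def evolCoeff (c : ℝ) : ℕ → DPoly × DPoly
  | 0 => (1, 0)
  | k + 1 => fluxD c (evolCoeff c k)

/-- The coefficient of `g(u)` in the total `t`-derivative. -/
def evolFst (c : ℝ) : Derivation ℝ DPoly DPoly := mkDerivation ℝ fun k => (evolCoeff c k).1

/-- The coefficient of `g'(u)` in the total `t`-derivative. -/
def evolSnd (c : ℝ) : Derivation ℝ DPoly DPoly := mkDerivation ℝ fun k => (evolCoeff c k).2

@[simp] lemma evolFst_X (c : ℝ) (k : ℕ) : evolFst c (X k) = (evolCoeff c k).1 :=
  mkDerivation_X _ _ _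

@[simp] lemma evolSnd_X (c : ℝ) (k : ℕ) : evolSnd c (X k) = (evolCoeff c k).2 :=
  mkDerivation_X _ _ _

/-- The total derivatives with respect to `t` and `x` commute. -/
lemma evol_totD (c : ℝ) (p : DPoly) :
    evolFst c (totD p) = totD (evolFst c p) + c • (X 0 * evolSnd c p) ∧
      evolSnd c (totD p) = totD (evolSnd c p) + X 0 * evolFst c p := by
  induction p using MvPolynomial.induction_on with
  | C a => simp
  | add p q hp hq =>
    simp only [map_add, hp.1, hp.2, hq.1, hq.2, mul_add, smul_add]
    constructor <;> abel
  | mul_X p k hp =>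
    simp only [Derivation.leibniz, smul_eq_mul, totD_X, map_add, hp.1, hp.2, evolFst_X, evolSnd_X,
      evolCoeff, fluxD, MvPolynomial.smul_eq_C_mul]
    constructor <;> ring

/-- The coefficients of the formal solution `y = ∑ yₙ λ⁻ⁿ` of the Riccati equation
`D y + 2 λ y = u_x - (c / 4) u_x y²`. -/
def riccati (c : ℝ) : ℕ → DPoly
  | 0 => 0
  | n + 1 => (1 / 2 : ℝ) • ((if n = 0 then X 0 else 0) - totD (riccati c n) -
      (c / 4) • (X 0 * ∑ i : Fin (n + 1), riccati c i * riccati c (n - i)))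

/-- The sum over `Fin` in the definition makes the recursion terminate; the sum over the
antidiagonal is the shape of a coefficient of a product of power series. -/
lemma riccati_succ (c : ℝ) (n : ℕ) :
    riccati c (n + 1) = (1 / 2 : ℝ) • ((if n = 0 then X 0 else 0) - totD (riccati c n) -
      (c / 4) • (X 0 * ∑ ij ∈ Finset.HasAntidiagonal.antidiagonal n,
        riccati c ij.1 * riccati c ij.2)) := by
  rw [riccati, Finset.Nat.sum_antidiagonal_eq_sum_range_succ
    (fun i j => riccati c i * riccati c j), ← Fin.sum_univ_eq_sum_range
    (fun i => riccati c i * riccati c (n - i))]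

/-! ### The Riccati generating series and its `t`-evolution -/

section PowerSeries

variable {A : Type*} [CommRing A] [Algebra ℝ A]

/-- A derivation applied to the coefficients of a power series. -/
def coeffDeriv (d : Derivation ℝ A A) (f : PowerSeries A) : PowerSeries A :=
  PowerSeries.mk fun n => d (PowerSeries.coeff n f)

@[simp] lemma coeff_coeffDeriv (d : Derivation ℝ A A) (f : PowerSeries A) (n : ℕ) :
    PowerSeries.coeff n (coeffDeriv d f) = d (PowerSeries.coeff n f) :=
  PowerSeries.coeff_mk _ _

lemma coeffDeriv_add (d : Derivation ℝ A A) (f h : PowerSeries A) :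
    coeffDeriv d (f + h) = coeffDeriv d f + coeffDeriv d h := by
  ext n; simp

lemma coeffDeriv_sub (d : Derivation ℝ A A) (f h : PowerSeries A) :
    coeffDeriv d (f - h) = coeffDeriv d f - coeffDeriv d h := by
  ext n; simp

lemma coeffDeriv_mul (d : Derivation ℝ A A) (f h : PowerSeries A) :
    coeffDeriv d (f * h) = coeffDeriv d f * h + f * coeffDeriv d h := by
  ext n
  simp only [coeff_coeffDeriv, PowerSeries.coeff_mul, map_add, map_sum, Derivation.leibniz,
    smul_eq_mul, ← Finset.sum_add_distrib]
  exact Finset.sum_congr rfl fun _ _ => by ring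

lemma coeffDeriv_C (d : Derivation ℝ A A) (a : A) :
    coeffDeriv d (PowerSeries.C a) = PowerSeries.C (d a) := by
  ext n
  simp only [coeff_coeffDeriv, PowerSeries.coeff_C]
  split_ifs <;> simp

lemma coeffDeriv_X (d : Derivation ℝ A A) : coeffDeriv d PowerSeries.X = 0 := by
  ext n
  simp only [coeff_coeffDeriv, PowerSeries.coeff_X]
  split_ifs <;> simp

end PowerSeries

/-- The generating function of the `riccati` polynomials, in the variable `1 / λ`. -/
def riccatiSeries (c : ℝ) : PowerSeries DPoly := PowerSeries.mk (riccati c)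

lemma riccatiSeries_eq (c : ℝ) :
    2 * riccatiSeries c = PowerSeries.X * (PowerSeries.C (X 0) - coeffDeriv totD (riccatiSeries c)
      - PowerSeries.C (C (c / 4) * X 0) * (riccatiSeries c * riccatiSeries c)) := by
  have h2 : (2 : PowerSeries DPoly) = PowerSeries.C (C 2) := by
      rw [show (C 2 : DPoly) = 2 from map_ofNat _ 2, map_ofNat]
  rw [h2]
  ext1 n
  rw [PowerSeries.coeff_C_mul]
  cases n with
  | zero => simp [riccatiSeries, riccati]
  | succ n =>
    rw [PowerSeries.coeff_succ_X_mul, riccatiSeries, PowerSeries.coeff_mk, riccati_succ, map_sub,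
      map_sub, PowerSeries.coeff_C_mul, PowerSeries.coeff_mul, PowerSeries.coeff_C]
    simp only [coeff_coeffDeriv, PowerSeries.coeff_mk, smul_eq_C_mul]
    rw [← mul_assoc, ← C_mul]
    norm_num
    ring

/-- The factor `PowerSeries.X` makes each coefficient of `z₁`, `z₂` depend only on strictly lower
ones, so they vanish one after another. -/
lemma series_eq_zero_of_linear {z₁ z₂ : PowerSeries DPoly} {a₁ a₂ b₁ b₂ : PowerSeries DPoly}
    (h₁ : 2 * z₁ = PowerSeries.X * (a₁ * z₁ + b₁ * z₂ - coeffDeriv totD z₁))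
    (h₂ : 2 * z₂ = PowerSeries.X * (a₂ * z₁ + b₂ * z₂ - coeffDeriv totD z₂)) :
    z₁ = 0 ∧ z₂ = 0 := by
  have h2 : (2 : PowerSeries DPoly) = PowerSeries.C (C 2) := by
      rw [show (C 2 : DPoly) = 2 from map_ofNat _ 2, map_ofNat]
  have key : ∀ n, ∀ m < n, PowerSeries.coeff m z₁ = 0 ∧ PowerSeries.coeff m z₂ = 0 := by
    intro n
    induction n with
    | zero => simp
    | succ n ih =>
      intro m hm
      rcases Nat.lt_succ_iff_lt_or_eq.mp hm with h | rfl
      · exact ih m h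
      have hC : (C 2 : DPoly) ≠ 0 := by simp
      have e₁ := congrArg (PowerSeries.coeff m) h₁
      have e₂ := congrArg (PowerSeries.coeff m) h₂
      rw [h2, PowerSeries.coeff_C_mul] at e₁ e₂
      cases m with
      | zero =>
        simp only [PowerSeries.coeff_zero_X_mul, mul_eq_zero, hC, false_or] at e₁ e₂
        exact ⟨e₁, e₂⟩
      | succ m =>
        have hz : ∀ (a z : PowerSeries DPoly), (∀ k < m + 1, PowerSeries.coeff k z = 0) →
            PowerSeries.coeff m (a * z) = 0 := by
          intro a z hk
          rw [PowerSeries.coeff_mul]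
          refine Finset.sum_eq_zero fun ij hij => ?_
          rw [hk ij.2 (by have := Finset.HasAntidiagonal.mem_antidiagonal.mp hij; omega), mul_zero]
        rw [PowerSeries.coeff_succ_X_mul, map_sub, map_add, hz _ _ fun k hk => (ih k hk).1,
          hz _ _ fun k hk => (ih k hk).2, coeff_coeffDeriv] at e₁ e₂
        rw [(ih m (by omega)).1] at e₁
        rw [(ih m (by omega)).2] at e₂
        simp only [map_zero, add_zero, sub_zero, mul_eq_zero, hC, false_or] at e₁ e₂
        exact ⟨e₁, e₂⟩
  constructor <;> ext1 n
  · simpa using (key (n + 1) n (by omega)).1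
  · simpa using (key (n + 1) n (by omega)).2

/-- The `t`-evolution of the solution of the Riccati equation. -/
lemma evol_riccatiSeries (c : ℝ) :
    coeffDeriv (evolFst c) (riccatiSeries c) = PowerSeries.X * (PowerSeries.C (C (1 / 2)) +
        PowerSeries.C (C (c / 8)) * (riccatiSeries c * riccatiSeries c)) ∧
      coeffDeriv (evolSnd c) (riccatiSeries c) =
        - (PowerSeries.X * (PowerSeries.C (C (1 / 2)) * riccatiSeries c)) := by
  set y := riccatiSeries c with hy
  have hR := riccatiSeries_eq c
  rw [← hy] at hR
  set μ : PowerSeries DPoly := PowerSeries.X with hμ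
  set v : PowerSeries DPoly := PowerSeries.C (X 0) with hv
  set k : PowerSeries DPoly := PowerSeries.C (C (c / 4)) with hk
  have hkv : PowerSeries.C (C (c / 4) * X 0 : DPoly) = k * v := by rw [map_mul]
  rw [hkv] at hR
  set e : PowerSeries DPoly := PowerSeries.C (C (1 / 2)) with he
  have he2 : 2 * e = 1 := by
    have h2 : (2 : PowerSeries DPoly) = PowerSeries.C (C 2) := by
      rw [show (C 2 : DPoly) = 2 from map_ofNat _ 2, map_ofNat]
    rw [h2, he, ← map_mul, ← map_mul]; norm_num
  have h8 : PowerSeries.C (C (c / 8) : DPoly) = e * k := by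
    rw [he, hk, ← map_mul, ← map_mul]; congr 2; ring
  have hc : PowerSeries.C (C c : DPoly) = 4 * k := by
    have h2 : (4 : PowerSeries DPoly) = PowerSeries.C (C 4) := by
      rw [show (C 4 : DPoly) = 4 from map_ofNat _ 4, map_ofNat]
    rw [hk, h2, ← map_mul, ← map_mul]; congr 2; ring
  rw [h8]
  have hd2 : ∀ d : Derivation ℝ DPoly DPoly, ∀ f, coeffDeriv d (2 * f) = 2 * coeffDeriv d f := by
    intro d f; rw [two_mul, coeffDeriv_add, two_mul]
  have hde : ∀ d : Derivation ℝ DPoly DPoly, coeffDeriv d e = 0 := fun d => by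
    rw [he, coeffDeriv_C]; simp
  have hdk : ∀ d : Derivation ℝ DPoly DPoly, coeffDeriv d k = 0 := fun d => by
    rw [hk, coeffDeriv_C]; simp
  have hdμ : ∀ d : Derivation ℝ DPoly DPoly, coeffDeriv d μ = 0 := fun d => coeffDeriv_X d
  have hv1 : coeffDeriv (evolFst c) v = 1 := by rw [hv, coeffDeriv_C]; simp [evolCoeff]
  have hv2 : coeffDeriv (evolSnd c) v = 0 := by rw [hv, coeffDeriv_C]; simp [evolCoeff]
  have hc1 : coeffDeriv (evolFst c) (coeffDeriv totD y) =
      coeffDeriv totD (coeffDeriv (evolFst c) y) + 4 * k * v * coeffDeriv (evolSnd c) y := by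
    rw [← hc, hv, ← map_mul]
    ext1 n
    rw [map_add, PowerSeries.coeff_C_mul]
    simp only [coeff_coeffDeriv, (evol_totD c _).1, smul_eq_C_mul]
    ring
  have hc2 : coeffDeriv (evolSnd c) (coeffDeriv totD y) =
      coeffDeriv totD (coeffDeriv (evolSnd c) y) + v * coeffDeriv (evolFst c) y := by
    rw [hv]
    ext1 n
    rw [map_add, PowerSeries.coeff_C_mul]
    simp only [coeff_coeffDeriv, (evol_totD c _).2]
  have hR1 := congrArg (coeffDeriv (evolFst c)) hR
  have hR2 := congrArg (coeffDeriv (evolSnd c)) hR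
  rw [hd2] at hR1 hR2
  simp only [coeffDeriv_mul, coeffDeriv_sub, hdμ, hdk, hv1, hv2, hc1, hc2] at hR1 hR2
  set y₁ := coeffDeriv (evolFst c) y
  set y₂ := coeffDeriv (evolSnd c) y
  -- `z₁`, `z₂` are the errors of the two claimed formulas. Differentiating the Riccati equation
  -- along `evolFst` and `evolSnd`, and correcting by multiples of the equation itself, shows that
  -- the errors solve a homogeneous linear system.
  have main := series_eq_zero_of_linear (z₁ := y₁ - μ * (e + e * k * (y * y)))
    (z₂ := y₂ + μ * (e * y)) (a₁ := -2 * k * v * y) (b₁ := -4 * k * v)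
    (a₂ := -v) (b₂ := -2 * k * v * y) ?_ ?_
  · exact ⟨sub_eq_zero.mp main.1, eq_neg_of_add_eq_zero_left main.2⟩
  · simp only [coeffDeriv_mul, coeffDeriv_sub, coeffDeriv_add, hdμ, hde, hdk]
    linear_combination hR1 - k * μ * y * hR + (-μ * (1 + k * y ^ 2) -
      k * μ ^ 2 * y * (-v + k * v * y ^ 2 + coeffDeriv totD y)) * he2
  · simp only [coeffDeriv_mul, coeffDeriv_add, hdμ, hde]
    linear_combination hR2 + μ * e * hR

/-- Comparison of coefficients; `n ≠ 0` discards the constant `1 / 2`, which contributes only to the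
evolution of `y₁`. -/
lemma evol_riccati (c : ℝ) {n : ℕ} (hn : n ≠ 0) :
    evolFst c (riccati c (n + 1)) = C (c / 8) *
        ∑ ij ∈ Finset.HasAntidiagonal.antidiagonal n, riccati c ij.1 * riccati c ij.2 ∧
      evolSnd c (riccati c (n + 1)) = -(C (1 / 2) * riccati c n) := by
  have h₁ := congrArg (PowerSeries.coeff (n + 1)) (evol_riccatiSeries c).1
  have h₂ := congrArg (PowerSeries.coeff (n + 1)) (evol_riccatiSeries c).2
  rw [coeff_coeffDeriv, PowerSeries.coeff_succ_X_mul, map_add, PowerSeries.coeff_C_mul,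
    PowerSeries.coeff_C, if_neg hn, zero_add, PowerSeries.coeff_mul] at h₁
  rw [coeff_coeffDeriv, map_neg, PowerSeries.coeff_succ_X_mul, PowerSeries.coeff_C_mul] at h₂
  simp only [riccatiSeries, PowerSeries.coeff_mk] at h₁ h₂
  exact ⟨h₁, h₂⟩

/-- The density `u_x yₙ₊₁` is conserved, with flux `- yₙ g(u) / 2`. -/
lemma evol_riccati_density (c : ℝ) {n : ℕ} (hn : n ≠ 0) :
    evolFst c (X 0 * riccati c (n + 1)) = (fluxD c (-(C (1 / 2) * riccati c n), 0)).1 ∧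
      evolSnd c (X 0 * riccati c (n + 1)) = (fluxD c (-(C (1 / 2) * riccati c n), 0)).2 := by
  have hh : (C (c / 4) : DPoly) = C 2 * C (c / 8) := by rw [← C_mul]; congr 1; ring
  have h2 : (C (1 / 2) * C 2 : DPoly) = 1 := by rw [← C_mul]; norm_num
  simp only [Derivation.leibniz, smul_eq_mul, evolFst_X, evolSnd_X, evolCoeff,
    (evol_riccati c hn).1, (evol_riccati c hn).2, fluxD, map_neg, derivation_C, map_zero, mul_zero, smul_zero, add_zero,
    mul_one, zero_add]
  refine ⟨?_, trivial⟩
  · rw [riccati_succ, if_neg hn]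
    simp only [smul_eq_C_mul, hh]
    linear_combination -C (c / 8) * X 0 * (∑ ij ∈ Finset.HasAntidiagonal.antidiagonal n,
      riccati c ij.1 * riccati c ij.2) * h2

/-! ### Weights and reduction of a density modulo total derivatives -/

section Weight

/-- The weight of the variable `X k = ∂ₓ^(k+1) u`. -/
abbrev jetWeight : ℕ → ℕ := fun k => k + 1

lemma totD_isWeightedHomogeneous {p : DPoly} {n : ℕ} (hp : IsWeightedHomogeneous jetWeight p n) :
    IsWeightedHomogeneous jetWeight (totD p) (n + 1) := by
  induction hp using IsWeightedHomogeneous.induction_on with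
  | zero => simpa using isWeightedHomogeneous_zero ℝ _ _
  | add p q _ _ hp hq => rw [map_add]; exact hp.add hq
  | monomial d r hr =>
    rw [totD, mkDerivation_monomial, smul_eq_C_mul]
    refine IsWeightedHomogeneous.C_mul (IsWeightedHomogeneous.sum _ _ _ fun i hi => ?_) r
    have h1 : d - Finsupp.single i 1 + Finsupp.single i 1 = d := by
      refine tsub_add_cancel_of_le ?_
      rw [Finsupp.single_le_iff]
      exact Nat.one_le_iff_ne_zero.mpr (Finsupp.mem_support_iff.mp hi)
    have h2 : Finsupp.weight jetWeight (d - Finsupp.single i 1) + (i + 1) = n := by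
      rw [← hr]
      conv_rhs => rw [← h1]
      rw [map_add, Finsupp.weight_single, one_smul]
    have := (isWeightedHomogeneous_monomial jetWeight (d - Finsupp.single i 1) ((d i : ℕ) : ℝ)
      rfl).mul (isWeightedHomogeneous_X ℝ jetWeight (i + 1))
    rw [show n + 1 = Finsupp.weight jetWeight (d - Finsupp.single i 1) + (i + 1 + 1) by omega]
    exact this

lemma riccati_isWeightedHomogeneous (c : ℝ) (n : ℕ) :
    IsWeightedHomogeneous jetWeight (riccati c n) n := by
  induction n using Nat.strong_induction_on with
  | _ n ih =>
    cases n with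
    | zero => rw [riccati]; exact isWeightedHomogeneous_zero ℝ _ _
    | succ n =>
      rw [riccati_succ, smul_eq_C_mul, smul_eq_C_mul]
      refine IsWeightedHomogeneous.C_mul (IsWeightedHomogeneous.sub (IsWeightedHomogeneous.sub ?_
        (totD_isWeightedHomogeneous (ih n (by omega)))) (IsWeightedHomogeneous.C_mul ?_ _)) _
      · split_ifs with h
        · subst h; exact isWeightedHomogeneous_X ℝ jetWeight 0
        · exact isWeightedHomogeneous_zero ℝ _ _
      · rw [add_comm n 1]
        refine (isWeightedHomogeneous_X ℝ jetWeight 0).mul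
          (IsWeightedHomogeneous.sum _ _ _ fun ij hij => ?_)
        have := Finset.HasAntidiagonal.mem_antidiagonal.mp hij
        rw [← this]
        exact (ih _ (by omega)).mul (ih _ (by omega))

lemma weight_of_ne_zero {d : ℕ →₀ ℕ} {i : ℕ} (hi : d i ≠ 0) :
    i + 1 ≤ Finsupp.weight jetWeight d :=
  Finsupp.le_weight_of_ne_zero' jetWeight hi

lemma lt_of_mem_vars {p : DPoly} {n : ℕ} (hp : IsWeightedHomogeneous jetWeight p n) {i : ℕ}
    (hi : i ∈ p.vars) : i < n := by
  obtain ⟨d, hd, hid⟩ := (mem_vars_iff_mem_support i).mp hi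
  rw [← hp (mem_support_iff.mp hd)]
  exact weight_of_ne_zero (Finsupp.mem_support_iff.mp hid)

lemma exists_eq_single_add {d : ℕ →₀ ℕ} (hd : d ≠ 0) :
    ∃ i d', d = Finsupp.single i 1 + d' := by
  obtain ⟨i, hi⟩ := Finsupp.ne_iff.mp hd
  refine ⟨i, d - Finsupp.single i 1, (add_tsub_cancel_of_le ?_).symm⟩
  rw [Finsupp.single_le_iff]
  exact Nat.one_le_iff_ne_zero.mpr hi

/-- The variable `X (q + j)` has weight `q + j + 1 > q`, so it occurs at most once in a monomial of
weight `2q`. Integration by parts moves one derivative to the cofactor, whose own weight is too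
small to produce a variable as high as `X (q + j)`. -/
lemma exists_reduction_step {q j : ℕ} {p : DPoly}
    (hp : IsWeightedHomogeneous jetWeight p (2 * q)) (hv : ∀ i ∈ p.vars, i < q + (j + 1)) :
    ∃ p' R : DPoly, p = p' + totD R ∧ IsWeightedHomogeneous jetWeight p' (2 * q) ∧
      ∀ i ∈ p'.vars, i < q + j := by
  classical
  have hmon : ∀ d ∈ p.support, ∃ p' R : DPoly, monomial d (coeff d p) = p' + totD R ∧
      IsWeightedHomogeneous jetWeight p' (2 * q) ∧ ∀ i ∈ p'.vars, i < q + j := by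
    intro d hd
    have hw : Finsupp.weight jetWeight d = 2 * q := hp (mem_support_iff.mp hd)
    have hlt : ∀ i, d i ≠ 0 → i < q + (j + 1) := fun i hi =>
      hv i ((mem_vars_iff_mem_support i).mpr ⟨d, hd, Finsupp.mem_support_iff.mpr hi⟩)
    by_cases h : d (q + j) = 0
    · refine ⟨monomial d (coeff d p), 0, by simp, isWeightedHomogeneous_monomial _ _ _ hw, ?_⟩
      intro i hi
      rw [vars_monomial (mem_support_iff.mp hd), Finsupp.mem_support_iff] at hi
      have := hlt i hi
      have : i ≠ q + j := fun e => hi (e ▸ h)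
      omega
    · set d' := d - Finsupp.single (q + j) 1 with hd'
      have h1 : d' + Finsupp.single (q + j) 1 = d := by
        refine tsub_add_cancel_of_le ?_
        rw [Finsupp.single_le_iff]
        exact Nat.one_le_iff_ne_zero.mpr h
      have h2 : Finsupp.weight jetWeight d' + (q + j + 1) = 2 * q := by
        rw [← hw]
        conv_rhs => rw [← h1]
        rw [map_add, Finsupp.weight_single, one_smul]
      set m : DPoly := monomial d' (coeff d p) with hm
      have hmw := totD_isWeightedHomogeneous (isWeightedHomogeneous_monomial jetWeight d'
        (coeff d p) (rfl : _ = Finsupp.weight jetWeight d'))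
      have hX : IsWeightedHomogeneous jetWeight (X (q + j - 1) : DPoly) (q + j) := by
        have := isWeightedHomogeneous_X ℝ jetWeight (q + j - 1)
        convert this using 1
        simp only [jetWeight]
        omega
      refine ⟨-(totD m * X (q + j - 1)), m * X (q + j - 1), ?_, ?_, ?_⟩
      · rw [Derivation.leibniz, totD_X, smul_eq_mul, smul_eq_mul,
          show q + j - 1 + 1 = q + j by omega]
        have : monomial d (coeff d p) = m * X (q + j) := by
          rw [hm, X, monomial_mul, h1, mul_one]
        rw [this]
        ring
      · rw [show 2 * q = Finsupp.weight jetWeight d' + 1 + (q + j) by omega]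
        exact (hmw.mul hX).neg
      · intro i hi
        rw [vars_neg] at hi
        rcases Finset.mem_union.mp (vars_mul _ _ hi) with hi | hi
        · have := lt_of_mem_vars hmw hi
          omega
        · rw [vars_X, Finset.mem_singleton] at hi
          omega
  have hsum : ∀ s : Finset (ℕ →₀ ℕ), s ⊆ p.support → ∃ p' R : DPoly,
      ∑ d ∈ s, monomial d (coeff d p) = p' + totD R ∧
      IsWeightedHomogeneous jetWeight p' (2 * q) ∧ ∀ i ∈ p'.vars, i < q + j := by
    intro s
    induction s using Finset.induction_on with
    | empty => exact fun _ => ⟨0, 0, by simp, isWeightedHomogeneous_zero ℝ _ _, by simp⟩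
    | insert d s hds ih =>
      intro hs
      obtain ⟨p₁, R₁, e₁, w₁, v₁⟩ := hmon d (hs (Finset.mem_insert_self _ _))
      obtain ⟨p₂, R₂, e₂, w₂, v₂⟩ := ih fun x hx => hs (Finset.mem_insert_of_mem hx)
      refine ⟨p₁ + p₂, R₁ + R₂, ?_, w₁.add w₂, fun i hi => ?_⟩
      · rw [Finset.sum_insert hds, e₁, e₂, map_add]; ring
      · rcases Finset.mem_union.mp (vars_add_subset _ _ hi) with hi | hi
        exacts [v₁ i hi, v₂ i hi]
  rw [p.as_sum]
  simpa using hsum p.support subset_rfl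

/-- A polynomial of weight `2 q` is, up to a total derivative, of order `q`. -/
lemma exists_reduction {q : ℕ} {p : DPoly}
    (hp : IsWeightedHomogeneous jetWeight p (2 * q)) :
    ∃ p' R : DPoly, p = p' + totD R ∧ IsWeightedHomogeneous jetWeight p' (2 * q) ∧
      ∀ i ∈ p'.vars, i < q := by
  have key : ∀ j : ℕ, ∀ p : DPoly, IsWeightedHomogeneous jetWeight p (2 * q) →
      (∀ i ∈ p.vars, i < q + j) → ∃ p' R : DPoly, p = p' + totD R ∧
        IsWeightedHomogeneous jetWeight p' (2 * q) ∧ ∀ i ∈ p'.vars, i < q := by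
    intro j
    induction j with
    | zero => exact fun p hp hv => ⟨p, 0, by simp, hp, hv⟩
    | succ j ih =>
      intro p hp hv
      obtain ⟨p₁, R₁, e₁, w₁, v₁⟩ := exists_reduction_step hp hv
      obtain ⟨p₂, R₂, e₂, w₂, v₂⟩ := ih p₁ w₁ v₁
      exact ⟨p₂, R₂ + R₁, by rw [e₁, e₂, map_add, add_assoc], w₂, v₂⟩
  exact key q p hp fun i hi => by
    have := lt_of_mem_vars hp hi
    omega

/-- Each factor has weight at most `q`, so a single factor cannot reach `2q`, and two factors reach
it only as the square of `∂ₓ^q u`. -/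
lemma eq_single_or_cubic {q : ℕ} {d : ℕ →₀ ℕ} (hq : q ≠ 0)
    (hw : Finsupp.weight jetWeight d = 2 * q) (hlt : ∀ i, d i ≠ 0 → i < q) :
    d = Finsupp.single (q - 1) 2 ∨
      ∃ i j k d', d = Finsupp.single i 1 + (Finsupp.single j 1 + (Finsupp.single k 1 + d')) := by
  have h0 : d ≠ 0 := by rintro rfl; simp at hw; omega
  obtain ⟨i, d₁, rfl⟩ := exists_eq_single_add h0
  have hi := hlt i (by simp)
  rw [map_add, Finsupp.weight_single, one_smul] at hw
  have h1 : d₁ ≠ 0 := by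
    rintro rfl
    simp only [map_zero, add_zero, jetWeight] at hw
    omega
  obtain ⟨j, d₂, rfl⟩ := exists_eq_single_add h1
  have hj := hlt j (by simp)
  by_cases h2 : d₂ = 0
  · left
    subst h2
    rw [add_zero, Finsupp.weight_single, one_smul] at hw
    simp only [jetWeight] at hw
    obtain rfl : i = q - 1 := by omega
    obtain rfl : j = q - 1 := by omega
    rw [add_zero, ← Finsupp.single_add]
  · obtain ⟨k, d₃, rfl⟩ := exists_eq_single_add h2
    exact Or.inr ⟨i, j, k, d₃, rfl⟩

end Weight

/-! ### Detecting the quadratic part of a density -/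

section QuadraticPart

/-- The evaluation `∂ₓ^(k+1) u ↦ ε + (-1)^k δ` in the ring `ℝ[ε, δ] / (ε², δ²)`. -/
def planeWave : DPoly →ₐ[ℝ] DualNumber (DualNumber ℝ) :=
  aeval (S₁ := DualNumber (DualNumber ℝ)) fun k => TrivSqZeroExt.inl (TrivSqZeroExt.inr 1) +
    TrivSqZeroExt.inr (TrivSqZeroExt.inl ((-1) ^ k))

lemma planeWave_X (k : ℕ) : (planeWave (X k)).fst.fst = 0 ∧ (planeWave (X k)).fst.snd = 1 ∧
    (planeWave (X k)).snd.fst = (-1) ^ k ∧ (planeWave (X k)).snd.snd = 0 := by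
  rw [planeWave, aeval_X]
  simp

/-- `ε` and `δ` play the roles of `eˣ` and `e⁻ˣ`: `totD` multiplies them by `1` and `-1`. Their
product behaves as a constant, so its component in a total derivative is zero. -/
lemma planeWave_totD (p : DPoly) : (planeWave (totD p)).fst.fst = 0 ∧
    (planeWave (totD p)).fst.snd = (planeWave p).fst.snd ∧
    (planeWave (totD p)).snd.fst = -(planeWave p).snd.fst ∧
    (planeWave (totD p)).snd.snd = 0 := by
  induction p using MvPolynomial.induction_on with
  | C a => 
    have : planeWave (C a) = algebraMap ℝ _ a := planeWave.commutes a
    rw [this]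
    simp [TrivSqZeroExt.algebraMap_eq_inl']
  | add p q hp hq =>
    obtain ⟨a1, a2, a3, a4⟩ := hp
    obtain ⟨b1, b2, b3, b4⟩ := hq
    simp [a1, a2, a3, a4, b1, b2, b3, b4]
    ring
  | mul_X p k hp =>
    obtain ⟨a1, a2, a3, a4⟩ := hp
    obtain ⟨b1, b2, b3, b4⟩ := planeWave_X k
    obtain ⟨c1, c2, c3, c4⟩ := planeWave_X (k + 1)
    simp [a1, a2, a3, a4, b1, b2, b3, b4, c1, c2, c3, c4, pow_succ]
    ring

lemma mul_mul_eq_zero_of_fst {a b e : DualNumber (DualNumber ℝ)} (ha : a.fst.fst = 0)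
    (hb : b.fst.fst = 0) (he : e.fst.fst = 0) : a * (b * e) = 0 := by
  ext <;> simp [ha, hb, he]

/-- The nonlinear term of the recursion is a product of three elements without constant term and
vanishes. What remains is `yₙ₊₁ = -D yₙ / 2` starting from `y₁ = u_x / 2`, with `D = 1` on `ε` and
`D = -1` on `δ`. -/
lemma planeWave_riccati (c : ℝ) (n : ℕ) : (planeWave (riccati c n)).fst.fst = 0 ∧
    (n ≠ 0 → (planeWave (riccati c n)).fst.snd = -(-1 / 2) ^ n ∧
      (planeWave (riccati c n)).snd.fst = (1 / 2) ^ n) := by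
  induction n using Nat.strong_induction_on with
  | _ n ih =>
    cases n with
    | zero => simp [riccati]
    | succ n =>
      obtain ⟨b1, b2, b3, b4⟩ := planeWave_X 0
      have hs : planeWave (X 0 * ∑ ij ∈ Finset.HasAntidiagonal.antidiagonal n,
          riccati c ij.1 * riccati c ij.2) = 0 := by
        rw [Finset.mul_sum, map_sum]
        refine Finset.sum_eq_zero fun ij hij => ?_
        have := Finset.HasAntidiagonal.mem_antidiagonal.mp hij
        rw [map_mul, map_mul]
        exact mul_mul_eq_zero_of_fst b1 (ih _ (by omega)).1 (ih _ (by omega)).1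
      obtain ⟨a1, a2, a3, a4⟩ := planeWave_totD (riccati c n)
      rw [riccati_succ, map_smul, map_sub, map_sub, map_smul, hs, smul_zero, sub_zero]
      by_cases hn : n = 0
      · subst hn
        norm_num [riccati, b1, b2, b3]
      · obtain ⟨h2, h3⟩ := (ih n (by omega)).2 hn
        simp [hn, a1, a2, a3, h2, h3, pow_succ]
        constructor <;> ring

/-- Apart from the square of `∂ₓ^q u` all monomials of `p` are at least cubic, and these die since
`ε² = δ² = 0`. The `εδ` component of that square is `2 (-1)^(q-1)`. -/
lemma planeWave_reduced {q : ℕ} (hq : q ≠ 0) {p : DPoly}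
    (hp : IsWeightedHomogeneous jetWeight p (2 * q)) (hv : ∀ i ∈ p.vars, i < q) :
    (planeWave p).snd.snd = coeff (Finsupp.single (q - 1) 2) p * (2 * (-1) ^ (q - 1)) := by
  classical
  obtain ⟨b1, b2, b3, b4⟩ := planeWave_X (q - 1)
  have hterm : ∀ d ∈ p.support, d ≠ Finsupp.single (q - 1) 2 →
      planeWave (monomial d (coeff d p)) = 0 := by
    intro d hd hne
    have hw : Finsupp.weight jetWeight d = 2 * q := hp (mem_support_iff.mp hd)
    rcases eq_single_or_cubic hq hw fun i hi =>
      hv i ((mem_vars_iff_mem_support i).mpr ⟨d, hd, Finsupp.mem_support_iff.mpr hi⟩) with h | h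
    · exact absurd h hne
    · obtain ⟨i, j, k, d', hd'⟩ := h
      have : monomial d (coeff d p) = X i * (X j * (X k * monomial d' (coeff d p))) := by
        rw [X, X, X, monomial_mul, monomial_mul, monomial_mul, one_mul, one_mul, one_mul, ← hd']
      rw [this, map_mul, map_mul, map_mul, ← mul_assoc (planeWave (X j)), ← mul_assoc,
        mul_mul_eq_zero_of_fst (planeWave_X i).1 (planeWave_X j).1 (planeWave_X k).1, zero_mul]
  have hsum : planeWave p =
      planeWave (monomial (Finsupp.single (q - 1) 2) (coeff (Finsupp.single (q - 1) 2) p)) := by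
    conv_lhs => rw [p.as_sum, map_sum]
    refine Finset.sum_eq_single _ hterm fun h => ?_
    rw [notMem_support_iff.mp h]
    simp
  have hmon : monomial (Finsupp.single (q - 1) 2) (coeff (Finsupp.single (q - 1) 2) p) =
      coeff (Finsupp.single (q - 1) 2) p • (X (q - 1) * X (q - 1)) := by
    rw [X, monomial_mul, smul_monomial, ← Finsupp.single_add]
    simp
  rw [hsum, hmon, map_smul, map_mul]
  simp [b1, b2, b3, b4]
  ring

end QuadraticPart

/-! ### Orders of derivatives, evolutions and fluxes -/

section Order

lemma notMem_vars_of_pderiv_eq_zero {p : DPoly} {i : ℕ} (h : pderiv i p = 0) : i ∉ p.vars := by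
  classical
  intro hi
  obtain ⟨d, hd, hid⟩ := (mem_vars_iff_mem_support i).mp hi
  have h1 : d - Finsupp.single i 1 + Finsupp.single i 1 = d := by
    refine tsub_add_cancel_of_le ?_
    rw [Finsupp.single_le_iff]
    exact Nat.one_le_iff_ne_zero.mpr (Finsupp.mem_support_iff.mp hid)
  have h2 := congrArg (coeff (d - Finsupp.single i 1)) h
  rw [coeff_pderiv, h1, coeff_zero, mul_eq_zero] at h2
  rcases h2 with h2 | h2
  · exact mem_support_iff.mp hd h2
  · exact (Nat.cast_add_one_pos (α := ℝ) _).ne' h2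

lemma forall_vars_lt_iff {p : DPoly} {n : ℕ} :
    (∀ i ∈ p.vars, i < n) ↔ ∀ k, n ≤ k → pderiv k p = 0 := by
  refine ⟨fun h k hk => pderiv_eq_zero_of_notMem_vars fun hv => ?_, fun h i hi => ?_⟩
  · exact absurd (h k hv) (by omega)
  · by_contra hlt
    exact notMem_vars_of_pderiv_eq_zero (h i (by omega)) hi

lemma pderiv_succ_totD (k : ℕ) (p : DPoly) :
    pderiv (k + 1) (totD p) = totD (pderiv (k + 1) p) + pderiv k p := by
  classical
  induction p using MvPolynomial.induction_on with
  | C a => simp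
  | add p q hp hq => simp only [map_add, hp, hq]; ring
  | mul_X p j hp =>
    simp only [Derivation.leibniz, smul_eq_mul, totD_X, map_add, hp, pderiv_X]
    have h : (Pi.single (k + 1) (1 : DPoly) : ℕ → DPoly) (j + 1) =
        (Pi.single k (1 : DPoly) : ℕ → DPoly) j := by
      simp [Pi.single_apply]
    have h' : totD ((Pi.single (k + 1) (1 : DPoly) : ℕ → DPoly) j) = 0 := by
      rw [Pi.single_apply]; split_ifs <;> simp
    rw [h, h']
    ring

lemma pderiv_iterate_totD {n : ℕ} (j : ℕ) {p : DPoly} (h : ∀ k, n < k → pderiv k p = 0) :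
    (∀ k, n + j < k → pderiv k (totD^[j] p) = 0) ∧
      pderiv (n + j) (totD^[j] p) = pderiv n p := by
  induction j with
  | zero => exact ⟨h, rfl⟩
  | succ j ih =>
    rw [Function.iterate_succ_apply']
    constructor
    · intro k hk
      obtain ⟨k, rfl⟩ : ∃ l, k = l + 1 := ⟨k - 1, by omega⟩
      rw [pderiv_succ_totD, ih.1 _ (by omega), ih.1 _ (by omega), map_zero, add_zero]
    · rw [← add_assoc, pderiv_succ_totD, ih.1 _ (by omega), map_zero, zero_add, ih.2]

lemma pderiv_evolCoeff (c : ℝ) (j : ℕ) : ∀ k, j ≤ k →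
    pderiv k (evolCoeff c j).1 = 0 ∧ pderiv k (evolCoeff c j).2 = 0 := by
  induction j with
  | zero => simp [evolCoeff]
  | succ j ih =>
    intro k hk
    obtain ⟨k, rfl⟩ : ∃ l, k = l + 1 := ⟨k - 1, by omega⟩
    have h0 : pderiv (k + 1) (X 0 : DPoly) = 0 := pderiv_X_of_ne (by omega)
    obtain ⟨a1, a2⟩ := ih k (by omega)
    obtain ⟨b1, b2⟩ := ih (k + 1) (by omega)
    simp [evolCoeff, fluxD, pderiv_succ_totD, Derivation.leibniz, h0, a1, a2, b1, b2]

/-- `∂ₜ ∂ₓ^(i+1) u` involves derivatives of order at most `i`, so for `k ≥ n` the commutator of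
`pderiv k` with the evolution kills every variable of `p`. -/
lemma pderiv_evol (c : ℝ) {n k : ℕ} (hk : n ≤ k) {p : DPoly} (hp : ∀ i ∈ p.vars, i < n) :
    pderiv k (evolFst c p) = 0 ∧ pderiv k (evolSnd c p) = 0 := by
  have hpk : pderiv k p = 0 := forall_vars_lt_iff.mp hp k hk
  have h : ∀ d : Derivation ℝ DPoly DPoly, (∀ i < n, pderiv k (d (X i)) = 0) →
      pderiv k (d p) = 0 := by
    intro d hd
    have : ⁅pderiv k, d⁆ p = 0 := derivation_eq_zero_of_forall_mem_vars fun i hi => by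
      rw [Derivation.commutator_apply, hd i (hp i hi),
        pderiv_X_of_ne (by have := hp i hi; omega), map_zero, sub_zero]
    rwa [Derivation.commutator_apply, hpk, map_zero, sub_zero] at this
  exact ⟨h _ fun i hi => by simpa using (pderiv_evolCoeff c i k (by omega)).1,
    h _ fun i hi => by simpa using (pderiv_evolCoeff c i k (by omega)).2⟩

/-- A top variable `X k` of `F` appears in the total derivative as `X (k + 1)`, with coefficient
`pderiv k F`. Starting from a crude bound, the order of `F` is pushed down until it meets that of
`fluxD c F`. -/
lemma pderiv_eq_zero_of_fluxD (c : ℝ) {n : ℕ} {F : DPoly × DPoly}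
    (h : ∀ k, n ≤ k → pderiv k (fluxD c F).1 = 0 ∧ pderiv k (fluxD c F).2 = 0) :
    ∀ k, n ≤ k → pderiv k F.1 = 0 ∧ pderiv k F.2 = 0 := by
  have hb : ∃ N, ∀ k, n + N ≤ k → pderiv k F.1 = 0 ∧ pderiv k F.2 = 0 := by
    refine ⟨F.1.vars.sup id + F.2.vars.sup id + 1, fun k hk => ⟨?_, ?_⟩⟩ <;>
    · refine pderiv_eq_zero_of_notMem_vars fun hv => ?_
      have : k ≤ _ := Finset.le_sup (f := id) hv
      omega
  obtain ⟨N, hN⟩ := hb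
  induction N with
  | zero => exact hN
  | succ N ih =>
    refine ih fun k hk => ?_
    rcases hk.lt_or_eq with hk | rfl
    · exact hN k (by omega)
    have h0 : pderiv (n + N + 1) (X 0 : DPoly) = 0 := pderiv_X_of_ne (by omega)
    obtain ⟨a1, a2⟩ := hN (n + N + 1) (by omega)
    simpa [fluxD, pderiv_succ_totD, Derivation.leibniz, h0, a1, a2] using
      h (n + N + 1) (by omega)

end Order

/-! ### Polynomial conserved densities of every order -/

lemma pderiv_pderiv_reduced {q : ℕ} {p : DPoly}
    (hp : IsWeightedHomogeneous jetWeight p (2 * q)) :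
    pderiv (q - 1) (pderiv (q - 1) p) = C (2 * coeff (Finsupp.single (q - 1) 2) p) := by
  classical
  ext m
  rw [coeff_pderiv, coeff_pderiv, coeff_C]
  split_ifs with h
  · subst h
    rw [zero_add, ← Finsupp.single_add]
    simp
    ring
  -- Two derivatives in `∂ₓ^q u` lower the weight by `2q`, to zero, and every nonzero exponent has
  -- positive weight.
  · rw [hp.coeff_eq_zero, zero_mul, zero_mul]
    rw [map_add, map_add, Finsupp.weight_single, one_smul]
    intro hw
    simp only [jetWeight] at hw
    have h0 : Finsupp.weight jetWeight m = 0 := by omega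
    apply h
    ext i
    by_contra hi
    have := weight_of_ne_zero (d := m) (i := i) (fun e => hi (by simp [e]))
    omega

/-- When `g'' = c g`, the equation `u_tx = g(u)` has a polynomial conserved density of every order
`q > 1` that is quadratic in the highest derivative. -/
theorem exists_conserved_density (c : ℝ) {q : ℕ} (hq : 1 < q) :
    ∃ (p : DPoly) (F : DPoly × DPoly) (a : ℝ), a ≠ 0 ∧ (∀ i ∈ p.vars, i < q) ∧
      (∀ i ∈ F.1.vars, i < q) ∧ (∀ i ∈ F.2.vars, i < q) ∧
      (evolFst c p, evolSnd c p) = fluxD c F ∧ pderiv (q - 1) (pderiv (q - 1) p) = C a := by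
  have hw : IsWeightedHomogeneous jetWeight (X 0 * riccati c (2 * q - 2 + 1)) (2 * q) := by
    have := (isWeightedHomogeneous_X ℝ jetWeight 0).mul
      (riccati_isWeightedHomogeneous c (2 * q - 2 + 1))
    rwa [show jetWeight 0 + (2 * q - 2 + 1) = 2 * q by simp only [jetWeight]; omega] at this
  obtain ⟨p, R, hp, hpw, hpv⟩ := exists_reduction hw
  set F₀ : DPoly × DPoly := (-(C (1 / 2) * riccati c (2 * q - 2)), 0) with hF₀
  -- Removing `totD R` from the density removes the `t`-derivative of `R` from the flux.
  set F : DPoly × DPoly := (F₀.1 - evolFst c R, F₀.2 - evolSnd c R) with hF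
  have hevol : (evolFst c p, evolSnd c p) = fluxD c F := by
    have hn : 2 * q - 2 ≠ 0 := by omega
    obtain ⟨e₁, e₂⟩ := evol_riccati_density c hn
    have hp' : p = X 0 * riccati c (2 * q - 2 + 1) - totD R := eq_sub_of_add_eq hp.symm
    rw [hp']
    simp only [map_sub, e₁, e₂, (evol_totD c R).1, (evol_totD c R).2]
    rw [← hF₀]
    simp only [hF, fluxD, map_sub, mul_sub, smul_sub]
    ext1 <;> dsimp only <;> abel
  have hFv := pderiv_eq_zero_of_fluxD c (n := q) (F := F) fun k hk => by
    rw [← hevol]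
    exact pderiv_evol c hk hpv
  refine ⟨p, F, _, ?_, hpv, forall_vars_lt_iff.mpr fun k hk => (hFv k hk).1,
    forall_vars_lt_iff.mpr fun k hk => (hFv k hk).2, hevol,
    pderiv_pderiv_reduced hpw⟩
  -- If the square of `∂ₓ^q u` were absent, the `εδ` component of `p + totD R` would be zero. For
  -- `u_x y_{2q-1}` it is `2 (1/2)^(2q-1)`: the two contributions add up because `2q - 1` is odd.
  intro h0
  have h1 : coeff (Finsupp.single (q - 1) 2) p = 0 := by linarith
  have h2 := planeWave_reduced (by omega) hpw hpv
  rw [h1, zero_mul] at h2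
  have h3 := congrArg (fun z => (planeWave z).snd.snd) hp
  obtain ⟨b1, b2, b3, b4⟩ := planeWave_X 0
  obtain ⟨c1, c2⟩ := planeWave_riccati c (2 * q - 2 + 1)
  obtain ⟨c2, c3⟩ := c2 (by omega)
  have hodd : Odd (2 * q - 2 + 1) := ⟨q - 1, by omega⟩
  rw [neg_div, hodd.neg_pow, neg_neg] at c2
  simp [h2, b1, b2, b3, b4, c1, c2, c3, (planeWave_totD R).2.2.2] at h3

/-! ### Partial derivatives of smooth functions of `(t, x)` -/

section PartialDerivatives

variable {Ω : Set (ℝ × ℝ)} {f : ℝ × ℝ → ℝ}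

lemma hasDerivAt_snd_of_differentiableAt {t x : ℝ} (hf : DifferentiableAt ℝ f (t, x)) :
    HasDerivAt (fun y => f (t, y)) (fderiv ℝ f (t, x) (0, 1)) x :=
  hf.hasFDerivAt.comp_hasDerivAt x ((hasDerivAt_const x t).prodMk (hasDerivAt_id x))

lemma hasDerivAt_fst_of_differentiableAt {t x : ℝ} (hf : DifferentiableAt ℝ f (t, x)) :
    HasDerivAt (fun s => f (s, x)) (fderiv ℝ f (t, x) (1, 0)) t :=
  hf.hasFDerivAt.comp_hasDerivAt t ((hasDerivAt_id t).prodMk (hasDerivAt_const t x))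

lemma differentiableAt_of_contDiffOn (hΩ : IsOpen Ω) (hf : ContDiffOn ℝ ∞ f Ω) {p : ℝ × ℝ}
    (hp : p ∈ Ω) : DifferentiableAt ℝ f p :=
  (hf.contDiffAt (hΩ.mem_nhds hp)).differentiableAt (by simp)

lemma contDiffOn_fderiv_apply {E : Type*} [NormedAddCommGroup E] [NormedSpace ℝ E] {D : Set E}
    {F : E → ℝ} (hD : IsOpen D) (hF : ContDiffOn ℝ ∞ F D) (v : E) :
    ContDiffOn ℝ ∞ (fun p => fderiv ℝ F p v) D :=
  (hF.fderiv_of_isOpen hD (m := ∞) (by simp)).clm_apply contDiffOn_const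

lemma fderiv_fderiv_apply_comm {E : Type*} [NormedAddCommGroup E] [NormedSpace ℝ E] {D : Set E}
    {F : E → ℝ} (hD : IsOpen D) (hF : ContDiffOn ℝ ∞ F D) {p : E} (hp : p ∈ D) (v w : E) :
    fderiv ℝ (fun p => fderiv ℝ F p v) p w = fderiv ℝ (fun p => fderiv ℝ F p w) p v := by
  have hat : ContDiffAt ℝ ∞ F p := hF.contDiffAt (hD.mem_nhds hp)
  have hd : DifferentiableAt ℝ (fderiv ℝ F) p :=
    (hat.fderiv_right (m := ∞) (by simp)).differentiableAt (by simp)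
  have hs := hat.isSymmSndFDerivAt (by
    rw [minSmoothness_of_isRCLikeNormedField]
    exact WithTop.coe_le_coe.2 (le_top (a := (2 : ℕ∞))))
  have h : ∀ v w : E, fderiv ℝ (fun p => fderiv ℝ F p v) p w = fderiv ℝ (fderiv ℝ F) p w v := by
    intro v w
    rw [fderiv_clm_apply hd (differentiableAt_const v)]
    simp
  rw [h, h]
  exact hs w v

/-- The mixed derivative of a smooth function can be computed in either order. -/
lemma hasDerivAt_deriv_swap (hΩ : IsOpen Ω) (hf : ContDiffOn ℝ ∞ f Ω) {G : ℝ × ℝ → ℝ} {G' t x : ℝ}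
    (hG : ∀ p ∈ Ω, HasDerivAt (fun s => f (s, p.2)) (G p) p.1) (htx : (t, x) ∈ Ω)
    (hG' : HasDerivAt (fun y => G (t, y)) G' x) :
    HasDerivAt (fun s => deriv (fun y => f (s, y)) x) G' t := by
  have hd : ∀ p ∈ Ω, DifferentiableAt ℝ f p := fun p hp => differentiableAt_of_contDiffOn hΩ hf hp
  have hx : HasDerivAt (fun s => fderiv ℝ f (s, x) (0, 1))
      (fderiv ℝ (fun p => fderiv ℝ f p (0, 1)) (t, x) (1, 0)) t :=
    hasDerivAt_fst_of_differentiableAt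
      (differentiableAt_of_contDiffOn hΩ (contDiffOn_fderiv_apply hΩ hf _) htx)
  have ht : HasDerivAt (fun y => fderiv ℝ f (t, y) (1, 0))
      (fderiv ℝ (fun p => fderiv ℝ f p (1, 0)) (t, x) (0, 1)) x :=
    hasDerivAt_snd_of_differentiableAt
      (differentiableAt_of_contDiffOn hΩ (contDiffOn_fderiv_apply hΩ hf _) htx)
  have e₁ : (fun s => deriv (fun y => f (s, y)) x) =ᶠ[nhds t]
      fun s => fderiv ℝ f (s, x) (0, 1) := by
    have : ∀ᶠ s in nhds t, (s, x) ∈ Ω :=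
      (Continuous.prodMk_left x).continuousAt.eventually (hΩ.mem_nhds htx)
    filter_upwards [this] with s hs
    exact (hasDerivAt_snd_of_differentiableAt (hd _ hs)).deriv
  have e₂ : (fun y => G (t, y)) =ᶠ[nhds x] fun y => fderiv ℝ f (t, y) (1, 0) := by
    have : ∀ᶠ y in nhds x, (t, y) ∈ Ω :=
      (Continuous.prodMk_right t).continuousAt.eventually (hΩ.mem_nhds htx)
    filter_upwards [this] with y hy
    exact (hG _ hy).unique (hasDerivAt_fst_of_differentiableAt (hd _ hy))
  have : G' = fderiv ℝ (fun p => fderiv ℝ f p (0, 1)) (t, x) (1, 0) := by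
    rw [fderiv_fderiv_apply_comm hΩ hf htx]
    exact hG'.unique (ht.congr_of_eventuallyEq e₂)
  rw [this]
  exact hx.congr_of_eventuallyEq e₁

/-- The derivative `∂ₓᵏ u`. -/
def xDeriv (u : ℝ × ℝ → ℝ) (k : ℕ) (p : ℝ × ℝ) : ℝ := iteratedDeriv k (fun y => u (p.1, y)) p.2

lemma xDeriv_zero (u : ℝ × ℝ → ℝ) : xDeriv u 0 = u := by
  ext p; simp [xDeriv]

lemma xDeriv_succ (u : ℝ × ℝ → ℝ) (k : ℕ) (p : ℝ × ℝ) :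
    xDeriv u (k + 1) p = deriv (fun y => xDeriv u k (p.1, y)) p.2 := by
  simp only [xDeriv, iteratedDeriv_succ]

variable {u : ℝ × ℝ → ℝ}

lemma contDiffOn_xDeriv (hΩ : IsOpen Ω) (hu : ContDiffOn ℝ ∞ u Ω) (k : ℕ) :
    ContDiffOn ℝ ∞ (xDeriv u k) Ω := by
  induction k with
  | zero => rwa [xDeriv_zero]
  | succ k ih =>
    refine (contDiffOn_fderiv_apply hΩ ih (0, 1)).congr fun p hp => ?_
    rw [xDeriv_succ]
    exact (hasDerivAt_snd_of_differentiableAt (differentiableAt_of_contDiffOn hΩ ih hp)).deriv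

lemma hasDerivAt_xDeriv (hΩ : IsOpen Ω) (hu : ContDiffOn ℝ ∞ u Ω) (k : ℕ) {t x : ℝ}
    (htx : (t, x) ∈ Ω) : HasDerivAt (fun y => xDeriv u k (t, y)) (xDeriv u (k + 1) (t, x)) x := by
  rw [xDeriv_succ]
  exact (hasDerivAt_snd_of_differentiableAt (differentiableAt_of_contDiffOn hΩ
    (contDiffOn_xDeriv hΩ hu k) htx)).differentiableAt.hasDerivAt

lemma IsSolutionOn.hasDerivAt_xDeriv_one {g : ℝ → ℝ} {I : Set ℝ} (hs : IsSolutionOn g I Ω u)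
    {t x : ℝ} (htx : (t, x) ∈ Ω) :
    HasDerivAt (fun s => xDeriv u 1 (s, x)) (g (u (t, x))) t := by
  have h := (hasDerivAt_fst_of_differentiableAt (differentiableAt_of_contDiffOn hs.isOpen
    (contDiffOn_xDeriv hs.isOpen hs.contDiffOn 1) htx)).differentiableAt.hasDerivAt
  have e : (fun s => xDeriv u 1 (s, x)) = fun s => deriv (fun y => u (s, y)) x := by
    ext s; rw [xDeriv_succ, xDeriv_zero]
  rw [← hs.eqn t x htx]
  rw [e] at h ⊢
  exact h

lemma hasDerivAt_xDeriv_succ_fst (hΩ : IsOpen Ω) (hu : ContDiffOn ℝ ∞ u Ω) {k : ℕ}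
    {G : ℝ × ℝ → ℝ} {G' t x : ℝ}
    (hG : ∀ p ∈ Ω, HasDerivAt (fun s => xDeriv u k (s, p.2)) (G p) p.1) (htx : (t, x) ∈ Ω)
    (hG' : HasDerivAt (fun y => G (t, y)) G' x) :
    HasDerivAt (fun s => xDeriv u (k + 1) (s, x)) G' t := by
  have := hasDerivAt_deriv_swap hΩ (contDiffOn_xDeriv hΩ hu k) hG htx hG'
  simpa only [xDeriv_succ] using this

end PartialDerivatives

/-! ### Differential polynomials as differential functions, and their multipliers -/

section Evaluation

lemma hasDerivAt_eval (d : Derivation ℝ DPoly DPoly) {γ : ℝ → ℕ → ℝ} {s : ℝ}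
    (h : ∀ k, HasDerivAt (fun r => γ r k) (eval (γ s) (d (X k))) s) (p : DPoly) :
    HasDerivAt (fun r => eval (γ r) p) (eval (γ s) (d p)) s := by
  induction p using MvPolynomial.induction_on with
  | C a => simpa using hasDerivAt_const s a
  | add p q hp hq => simpa using hp.fun_add hq
  | mul_X p k hp =>
    have := hp.fun_mul (h k)
    simp only [Derivation.leibniz, map_add, map_mul, smul_eq_mul, eval_X]
    exact this.congr_deriv (by ring)

lemma eval_congr_of_vars {p : DPoly} {v w : ℕ → ℝ} (h : ∀ i ∈ p.vars, v i = w i) :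
    eval v p = eval w p :=
  eval₂Hom_congr' rfl (fun i hi _ => h i hi) rfl

/-- A differential polynomial, seen as a differential function. -/
def polyFun (p : DPoly) : DiffFun := fun _ w => eval (fun k => w (k + 1)) p

lemma jetDeriv_succ_polyFun (k : ℕ) (p : DPoly) :
    jetDeriv (k + 1) (polyFun p) = polyFun (pderiv k p) := by
  classical
  ext x w
  have h := hasDerivAt_eval (pderiv k) (s := w (k + 1))
    (γ := fun s j => Function.update w (k + 1) s (j + 1)) (fun j => ?_) p
  · have := h.deriv
    simp only [Function.update_eq_self] at this
    exact this
  · rw [pderiv_X, Pi.single_apply]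
    by_cases hj : j = k
    · subst hj
      simpa using hasDerivAt_id' (w (j + 1))
    · simpa [hj] using hasDerivAt_const (w (k + 1)) (w (j + 1))

lemma jetDeriv_zero_polyFun (p : DPoly) (x : ℝ) (w : ℕ → ℝ) : jetDeriv 0 (polyFun p) x w = 0 := by
  simp [jetDeriv, polyFun]

lemma derivation_sum_apply (s : Finset ℕ) (d : ℕ → Derivation ℝ DPoly DPoly) (p : DPoly) :
    (∑ k ∈ s, d k) p = ∑ k ∈ s, d k p := by
  classical
  induction s using Finset.induction_on with
  | empty => simp
  | insert k s hk ih => rw [Finset.sum_insert hk, Finset.sum_insert hk, Derivation.add_apply, ih]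

lemma totalDx_polyFun (p : DPoly) : totalDx (polyFun p) = polyFun (totD p) := by
  ext x w
  have h0 : deriv (fun y => polyFun p y w) x = 0 := by simp [polyFun]
  rw [totalDx, h0, zero_add]
  set N := p.vars.sup id + 1 with hN
  have hlt : ∀ i ∈ p.vars, i < N := fun i hi => Nat.lt_succ_of_le (Finset.le_sup (f := id) hi)
  have hD : totD p = ∑ k ∈ Finset.range N, X (k + 1) * pderiv k p := by
    have : totD p = (∑ k ∈ Finset.range N, (X (k + 1) : DPoly) • (pderiv k :
        Derivation ℝ DPoly DPoly)) p := by
      refine derivation_eq_of_forall_mem_vars fun i hi => ?_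
      classical
      rw [totD_X, derivation_sum_apply, Finset.sum_eq_single i]
      · simp
      · intro k _ hk
        simp [pderiv_X_of_ne (R := ℝ) hk.symm]
      · exact fun h => absurd (Finset.mem_range.mpr (hlt i hi)) h
    rw [this, derivation_sum_apply]
    rfl
  have hsub : (Function.support fun k => w (k + 1) * jetDeriv k (polyFun p) x w) ⊆
      (Finset.range (N + 1) : Finset ℕ) := by
    intro k hk
    by_contra hn
    apply hk
    cases k with
    | zero => simp at hn
    | succ k =>
      have : pderiv k p = 0 := forall_vars_lt_iff.mp hlt k (by simpa using hn)
      simp only [jetDeriv_succ_polyFun, this]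
      simp [polyFun]
  rw [finsum_eq_sum_of_support_subset _ hsub, Finset.sum_range_succ', jetDeriv_zero_polyFun,
    mul_zero, add_zero, hD]
  simp only [jetDeriv_succ_polyFun, polyFun, map_sum, map_mul, eval_X]

lemma iterate_neg_totalDx_polyFun (k : ℕ) (p : DPoly) :
    (fun F : DiffFun => -totalDx F)^[k] (polyFun p) = polyFun ((-1) ^ k * totD^[k] p) := by
  induction k with
  | zero => simp
  | succ k ih =>
    rw [Function.iterate_succ_apply', ih, Function.iterate_succ_apply']
    have h : ((-1 : DPoly) ^ k) = C ((-1) ^ k) := by simp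
    have h' : ((-1 : DPoly) ^ (k + 1)) = C ((-1) ^ (k + 1)) := by simp
    ext x w
    simp only [Pi.neg_apply, totalDx_polyFun, h, h', Derivation.leibniz, derivation_C]
    simp [polyFun, pow_succ]

lemma multiplier_eq_polyFun {q : ℕ} {P : ℝ × (Fin (q + 1) → ℝ) → ℝ} {p : DPoly}
    (hP : toDiffFun P = polyFun p) :
    multiplier P = polyFun (∑ k ∈ Finset.range q, (-1) ^ k * totD^[k] (pderiv k p)) := by
  ext x w
  simp only [multiplier, hP, jetDeriv_succ_polyFun, iterate_neg_totalDx_polyFun]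
  simp only [polyFun, map_sum]

/-- The `k`-th summand has order at most `q + k`, so only `k = q - 1` reaches order `2q - 1`. Each
total derivative raises the top variable by one without changing its coefficient. The index `2q - 2`
stands for `∂ₓ^(2q-1) u`. -/
lemma pderiv_multiplier {q : ℕ} (hq : q ≠ 0) {p : DPoly} (hp : ∀ i ∈ p.vars, i < q) :
    (∀ m, 2 * q - 2 < m →
      pderiv m (∑ k ∈ Finset.range q, (-1) ^ k * totD^[k] (pderiv k p)) = 0) ∧
    pderiv (2 * q - 2) (∑ k ∈ Finset.range q, (-1) ^ k * totD^[k] (pderiv k p)) =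
      (-1) ^ (q - 1) * pderiv (q - 1) (pderiv (q - 1) p) := by
  have hcomm : ∀ i j, pderiv i (pderiv j p) = pderiv j (pderiv i p) := by
    intro i j
    classical
    ext m
    simp only [coeff_pderiv]
    by_cases hij : i = j
    · subst hij; rfl
    · simp only [Finsupp.add_apply, Finsupp.single_eq_of_ne hij,
        Finsupp.single_eq_of_ne (Ne.symm hij), add_zero, add_right_comm m]
      ring
  have hz : ∀ k j, q - 1 < j → pderiv j (pderiv k p) = 0 := fun k j hj => by
    rw [hcomm, forall_vars_lt_iff.mp hp j (by omega), map_zero]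
  have hneg : ∀ k m (r : DPoly), pderiv m ((-1) ^ k * r) = (-1) ^ k * pderiv m r := by
    intro k m r
    have h : ((-1 : DPoly) ^ k) = C ((-1) ^ k) := by simp
    rw [h, pderiv_C_mul]
  have hlow : ∀ m k, k < q → q - 1 + k < m → pderiv m ((-1) ^ k * totD^[k] (pderiv k p)) = 0 :=
    fun m k _ hm => by rw [hneg, (pderiv_iterate_totD k (hz k)).1 m hm, mul_zero]
  constructor
  · intro m hm
    rw [map_sum]
    refine Finset.sum_eq_zero fun k hk => ?_
    have := Finset.mem_range.mp hk
    exact hlow m k this (by omega)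
  · rw [map_sum, Finset.sum_eq_single (q - 1)]
    · rw [hneg, show 2 * q - 2 = q - 1 + (q - 1) by omega, (pderiv_iterate_totD _ (hz _)).2]
    · intro k hk hne
      have := Finset.mem_range.mp hk
      exact hlow _ k this (by omega)
    · exact fun h => absurd (Finset.mem_range.mpr (by omega)) h

end Evaluation

/-! ### Conservation laws of every order when `g'' = c g` -/

section Sufficiency

variable {g : ℝ → ℝ} {I : Set ℝ} {Ω : Set (ℝ × ℝ)} {u : ℝ × ℝ → ℝ} {c : ℝ}

/-- The value of the differential polynomial `p` on the function `u`. -/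
def evalOn (u : ℝ × ℝ → ℝ) (p : DPoly) (z : ℝ × ℝ) : ℝ := eval (fun k => xDeriv u (k + 1) z) p

lemma hasDerivAt_flux (hI : IsOpen I) (hg : ContDiffOn ℝ ∞ g I)
    (hc : ∀ v ∈ I, deriv (deriv g) v = c * g v) (hs : IsSolutionOn g I Ω u) (F : DPoly × DPoly)
    {t x : ℝ} (htx : (t, x) ∈ Ω) :
    HasDerivAt (fun y => evalOn u F.1 (t, y) * g (u (t, y)) + evalOn u F.2 (t, y) *
        deriv g (u (t, y)))
      (evalOn u (fluxD c F).1 (t, x) * g (u (t, x)) + evalOn u (fluxD c F).2 (t, x) *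
        deriv g (u (t, x))) x := by
  have huI : u (t, x) ∈ I := hs.mapsTo htx
  have hu : HasDerivAt (fun y => u (t, y)) (xDeriv u 1 (t, x)) x := by
    simpa only [xDeriv_zero] using hasDerivAt_xDeriv hs.isOpen hs.contDiffOn 0 htx
  have hp : ∀ p, HasDerivAt (fun y => evalOn u p (t, y)) (evalOn u (totD p) (t, x)) x := by
    intro p
    refine hasDerivAt_eval totD (γ := fun y k => xDeriv u (k + 1) (t, y)) (fun k => ?_) p
    simpa using hasDerivAt_xDeriv hs.isOpen hs.contDiffOn (k + 1) htx
  have hg1 : HasDerivAt g (deriv g (u (t, x))) (u (t, x)) :=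
    ((hg.contDiffAt (hI.mem_nhds huI)).differentiableAt (by simp)).hasDerivAt
  have hg' : ContDiffOn ℝ ∞ (deriv g) I := ((contDiffOn_infty_iff_deriv_of_isOpen hI).mp hg).2
  have hg2 : HasDerivAt (deriv g) (c * g (u (t, x))) (u (t, x)) := by
    rw [← hc _ huI]
    exact ((hg'.contDiffAt (hI.mem_nhds huI)).differentiableAt (by simp)).hasDerivAt
  have h := ((hp F.1).mul (hg1.comp x hu)).add ((hp F.2).mul (hg2.comp x hu))
  refine h.congr_deriv ?_
  simp only [fluxD, evalOn, map_add, map_mul, smul_eval, eval_X, Function.comp_apply]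
  ring

lemma hasDerivAt_xDeriv_fst (hI : IsOpen I) (hg : ContDiffOn ℝ ∞ g I)
    (hc : ∀ v ∈ I, deriv (deriv g) v = c * g v) (hs : IsSolutionOn g I Ω u) (k : ℕ) :
    ∀ z ∈ Ω, HasDerivAt (fun s => xDeriv u (k + 1) (s, z.2))
      (evalOn u (evolCoeff c k).1 z * g (u z) + evalOn u (evolCoeff c k).2 z *
        deriv g (u z)) z.1 := by
  induction k with
  | zero =>
    intro z hz
    simpa [evolCoeff, evalOn] using hs.hasDerivAt_xDeriv_one hz
  | succ k ih =>
    intro z hz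
    exact hasDerivAt_xDeriv_succ_fst hs.isOpen hs.contDiffOn ih hz
      (hasDerivAt_flux hI hg hc hs (evolCoeff c k) hz)

lemma hasDerivAt_evalOn_fst (hI : IsOpen I) (hg : ContDiffOn ℝ ∞ g I)
    (hc : ∀ v ∈ I, deriv (deriv g) v = c * g v) (hs : IsSolutionOn g I Ω u) (p : DPoly)
    {t x : ℝ} (htx : (t, x) ∈ Ω) :
    HasDerivAt (fun s => evalOn u p (s, x))
      (evalOn u (evolFst c p) (t, x) * g (u (t, x)) + evalOn u (evolSnd c p) (t, x) *
        deriv g (u (t, x))) t := by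
  -- With the values of `g` and `g'` at the point frozen as scalars, the total `t`-derivative is
  -- itself a derivation of the polynomial ring.
  have h := hasDerivAt_eval (g (u (t, x)) • evolFst c + deriv g (u (t, x)) • evolSnd c)
    (γ := fun s k => xDeriv u (k + 1) (s, x)) (s := t) (fun k => ?_) p
  · refine h.congr_deriv ?_
    simp only [evalOn, Derivation.add_apply, Derivation.smul_apply, map_add, smul_eval]
    ring
  · refine (hasDerivAt_xDeriv_fst hI hg hc hs k (t, x) htx).congr_deriv ?_
    simp only [evalOn, Derivation.add_apply, Derivation.smul_apply, map_add, smul_eval, evolFst_X,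
      evolSnd_X]
    ring

/-- The variables of differential polynomials, read off from a jet of order `q`. -/
def jetVars {q : ℕ} (z : ℝ × (Fin (q + 1) → ℝ)) (k : ℕ) : ℝ :=
  if h : k + 1 < q + 1 then z.2 ⟨k + 1, h⟩ else 0

lemma contDiff_eval_jetVars {q : ℕ} (p : DPoly) :
    ContDiff ℝ ∞ fun z : ℝ × (Fin (q + 1) → ℝ) => eval (jetVars z) p := by
  have hv : ∀ k, ContDiff ℝ ∞ fun z : ℝ × (Fin (q + 1) → ℝ) => jetVars z k := by
    intro k
    unfold jetVars
    split_ifs with h <;> fun_prop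
  induction p using MvPolynomial.induction_on with
  | C a => simpa using contDiff_const
  | add p r hp hr => simpa using hp.add hr
  | mul_X p k hp => simpa using hp.mul (hv k)

lemma eval_jetVars_xJet {q : ℕ} {p : DPoly} (hp : ∀ i ∈ p.vars, i < q) (u : ℝ × ℝ → ℝ) (t x : ℝ) :
    eval (jetVars (xJet q u t x)) p = evalOn u p (t, x) :=
  eval_congr_of_vars fun i hi => by
    have := hp i hi
    rw [jetVars, dif_pos (by omega)]
    rfl

theorem exists_isConservationLaw (hI : IsOpen I) (hne : I.Nonempty) (hg : ContDiffOn ℝ ∞ g I)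
    (hc : ∀ v ∈ I, deriv (deriv g) v = c * g v) {q : ℕ} (hq : 1 < q) :
    ∃ Pt Px : ℝ × (Fin (q + 1) → ℝ) → ℝ, IsConservationLaw g I q Set.univ Pt Px := by
  obtain ⟨p, F, a, ha, hpv, hF1, hF2, hev, hpp⟩ := exists_conserved_density c hq
  have hg' : ContDiffOn ℝ ∞ (deriv g) I := ((contDiffOn_infty_iff_deriv_of_isOpen hI).mp hg).2
  have hcoord : ContDiffOn ℝ ∞ (fun z : ℝ × (Fin (q + 1) → ℝ) => z.2 0)
    (jetDomain I Set.univ) := by fun_prop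
  have hmaps : Set.MapsTo (fun z : ℝ × (Fin (q + 1) → ℝ) => z.2 0) (jetDomain I Set.univ) I :=
    fun z hz => hz.1
  -- The algebra gives `D_t p = D_x F`, whence the minus sign in the flux.
  refine ⟨fun z => eval (jetVars z) p, fun z => -(eval (jetVars z) F.1 * g (z.2 0) +
    eval (jetVars z) F.2 * deriv g (z.2 0)), ?_, ?_, ?_, ?_⟩
  · exact (contDiff_eval_jetVars p).contDiffOn
  · exact (((contDiff_eval_jetVars _).contDiffOn.mul (hg.comp hcoord hmaps)).add
      ((contDiff_eval_jetVars _).contDiffOn.mul (hg'.comp hcoord hmaps))).neg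
  · intro Ω u hs _ t x htx
    have h1 := hasDerivAt_evalOn_fst hI hg hc hs p htx
    have h2 := (hasDerivAt_flux hI hg hc hs F htx).fun_neg
    have e0 : ∀ y, (xJet q u t y).2 0 = u (t, y) := fun y => by simp [xJet]
    simp only [eval_jetVars_xJet hpv, eval_jetVars_xJet hF1, eval_jetVars_xJet hF2, e0]
    rw [h1.deriv, h2.deriv, ← hev]
    ring
  · have hP : toDiffFun (fun z : ℝ × (Fin (q + 1) → ℝ) => eval (jetVars z) p) = polyFun p := by
      ext x w
      refine eval_congr_of_vars fun i hi => ?_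
      have := hpv i hi
      rw [jetVars, dif_pos (by omega)]
    obtain ⟨hm, htop⟩ := pderiv_multiplier (by omega) hpv
    refine ⟨2 * q - 2 + 1, by omega, ?_, ?_⟩
    · obtain ⟨v, hv⟩ := hne
      refine ⟨0, fun _ => v, ⟨hv, trivial⟩, ?_⟩
      rw [multiplier_eq_polyFun hP, jetDeriv_succ_polyFun, htop, hpp]
      simp [polyFun, ha]
    · intro m hlt x w _
      obtain ⟨m, rfl⟩ : ∃ l, m = l + 1 := ⟨m - 1, by omega⟩
      rw [multiplier_eq_polyFun hP, jetDeriv_succ_polyFun, hm m (by omega)]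
      simp [polyFun]

end Sufficiency

/-! ### Solutions of the form `W(t (x + a))` through a given jet -/

section SimilaritySolutions

variable {g : ℝ → ℝ} {I : Set ℝ}

lemma contDiffOn_of_hasDerivAt {E : Type*} [NormedAddCommGroup E] [NormedSpace ℝ E] {f : E → E}
    {N : Set E} (hf : ContDiffOn ℝ ∞ f N) {J : Set ℝ} (hJ : IsOpen J) {α : ℝ → E}
    (hα : ∀ s ∈ J, HasDerivAt α (f (α s)) s) (hN : Set.MapsTo α J N) : ContDiffOn ℝ ∞ α J := by
  refine contDiffOn_infty.mpr fun n => ?_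
  induction n with
  | zero =>
    exact contDiffOn_zero.mpr fun s hs => (hα s hs).continuousAt.continuousWithinAt
  | succ n ih =>
    rw [Nat.cast_succ, contDiffOn_succ_iff_deriv_of_isOpen hJ]
    refine ⟨fun s hs => (hα s hs).differentiableAt.differentiableWithinAt, by simp, ?_⟩
    refine ((hf.of_le ?_).comp ih hN).congr fun s hs => (hα s hs).deriv
    exact_mod_cast (le_top : (n : ℕ∞) ≤ ⊤)

/-- Local solutions of the ordinary differential equation `z W'' + W' = g(W)`. -/
lemma exists_similarity_profile (hI : IsOpen I) (hg : ContDiffOn ℝ ∞ g I) {u₀ : ℝ} (hu₀ : u₀ ∈ I)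
    (y₀ : ℝ) {z₀ : ℝ} (hz₀ : z₀ ≠ 0) :
    ∃ (J : Set ℝ) (W Y : ℝ → ℝ), IsOpen J ∧ z₀ ∈ J ∧ (∀ z ∈ J, z ≠ 0) ∧ ContDiffOn ℝ ∞ W J ∧
      Set.MapsTo W J I ∧ W z₀ = u₀ ∧ Y z₀ = y₀ ∧
      ∀ z ∈ J, HasDerivAt W (Y z) z ∧ HasDerivAt Y ((g (W z) - Y z) / z) z := by
  set N : Set (ℝ × ℝ × ℝ) := {s | s.1 ≠ 0 ∧ s.2.1 ∈ I} with hN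
  have hNo : IsOpen N := (isOpen_ne.preimage continuous_fst).inter
    (hI.preimage (continuous_fst.comp continuous_snd))
  -- Taking the independent variable as a first component with derivative `1` makes the equation
  -- autonomous; `hid` below identifies that component with the parameter.
  set f : ℝ × ℝ × ℝ → ℝ × ℝ × ℝ := fun s => (1, s.2.2, (g s.2.1 - s.2.2) / s.1) with hf
  have hfN : ContDiffOn ℝ ∞ f N := by
    have h1 : ContDiffOn ℝ ∞ (fun s : ℝ × ℝ × ℝ => g s.2.1) N :=
      hg.comp (t := I) (by fun_prop) fun s hs => hs.2
    refine contDiffOn_const.prodMk (ContDiffOn.prodMk (by fun_prop) ?_)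
    exact (h1.sub (by fun_prop)).div (by fun_prop) fun s hs => hs.1
  have h₀ : (z₀, u₀, y₀) ∈ N := ⟨hz₀, hu₀⟩
  have hat : ContDiffAt ℝ 1 f (z₀, u₀, y₀) :=
    (hfN.contDiffAt (hNo.mem_nhds h₀)).of_le (by exact_mod_cast (le_top : (1 : ℕ∞) ≤ ⊤))
  obtain ⟨α, hα₀, ε, hε, hα⟩ :=
    hat.exists_forall_mem_closedBall_exists_eq_forall_mem_Ioo_hasDerivAt₀ z₀
  set K := Set.Ioo (z₀ - ε) (z₀ + ε) with hK
  have hzK : z₀ ∈ K := ⟨by linarith, by linarith⟩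
  have hcont : ContinuousOn α K := fun s hs => (hα s hs).continuousAt.continuousWithinAt
  have hJo : IsOpen (K ∩ α ⁻¹' N) := hcont.isOpen_inter_preimage isOpen_Ioo hNo
  have hid : ∀ s ∈ K, (α s).1 = s := by
    have hd : ∀ s ∈ K, HasDerivAt (fun s => (α s).1 - s) 0 s := by
      intro s hs
      have h : HasDerivAt (fun s => (α s).1) 1 s := (hα s hs).fst
      simpa using h.fun_sub (hasDerivAt_id' s)
    intro s hs
    have := isOpen_Ioo.is_const_of_deriv_eq_zero isPreconnected_Ioo
      (fun s hs => (hd s hs).differentiableAt.differentiableWithinAt)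
      (fun s hs => (hd s hs).deriv) hs hzK
    simp only [hα₀, sub_self] at this
    linarith
  have hsm : ContDiffOn ℝ ∞ α (K ∩ α ⁻¹' N) :=
    contDiffOn_of_hasDerivAt hfN hJo (fun s hs => hα s hs.1) fun s hs => hs.2
  refine ⟨K ∩ α ⁻¹' N, fun s => (α s).2.1, fun s => (α s).2.2, hJo, ⟨hzK, by simpa [hα₀] using h₀⟩,
    fun z hz => by simpa [hid z hz.1] using hz.2.1, hsm.snd.fst, fun z hz => hz.2.2, by simp [hα₀],
    by simp [hα₀], fun z hz => ⟨(hα z hz.1).snd.fst, ?_⟩⟩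
  have h : HasDerivAt (fun s => (α s).2.2) ((g (α z).2.1 - (α z).2.2) / (α z).1) z :=
    (hα z hz.1).snd.snd
  rwa [hid z hz.1] at h

/-- A solution through a jet with prescribed `u`, `u_x ≠ 0`, `u_xx`, and `u_t = ρ u_x`. -/
lemma exists_similarity_solution (hI : IsOpen I) (hg : ContDiffOn ℝ ∞ g I) {u₀ x₀ p r ρ : ℝ}
    (hu₀ : u₀ ∈ I) (hp : p ≠ 0) (hρ : ρ ≠ 0) (hκ : g u₀ - ρ * r ≠ 0) :
    ∃ (Ω : Set (ℝ × ℝ)) (u : ℝ × ℝ → ℝ) (t₀ : ℝ), IsSolutionOn g I Ω u ∧ (t₀, x₀) ∈ Ω ∧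
      u (t₀, x₀) = u₀ ∧ xDeriv u 1 (t₀, x₀) = p ∧ xDeriv u 2 (t₀, x₀) = r ∧
      xDeriv u 3 (t₀, x₀) = deriv g u₀ * p / ρ - 2 * r * (g u₀ - ρ * r) / (ρ * p) ∧
      HasDerivAt (fun s => u (s, x₀)) (ρ * p) t₀ := by
  -- At the base point `κ = W'(z₀)`, `β = t₀` and `x₀ + a = ρ β`. Then `u_x = β κ = p`, `u_t = ρ β κ
  -- = ρ p`, and the profile equation gives `u_xx = (g(u₀) - κ) / ρ = r`.
  set κ := g u₀ - ρ * r with hκd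
  set β := p / κ with hβ
  have hβ0 : β ≠ 0 := div_ne_zero hp hκ
  obtain ⟨J, W, Y, hJ, hz₀, hJ0, hW, hWI, hWz, hYz, hd⟩ :=
    exists_similarity_profile hI hg hu₀ κ (z₀ := β * (ρ * β)) (by positivity)
  set a := ρ * β - x₀ with ha
  set Ω : Set (ℝ × ℝ) := {q | q.1 * (q.2 + a) ∈ J} with hΩ
  set u : ℝ × ℝ → ℝ := fun q => W (q.1 * (q.2 + a)) with hu
  have hΩo : IsOpen Ω := hJ.preimage (by fun_prop)
  have hmem : (β, x₀) ∈ Ω := by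
    change β * (x₀ + a) ∈ J
    rw [ha, add_sub_cancel]; exact hz₀
  have ne : ∀ q ∈ Ω, q.1 ≠ 0 ∧ q.2 + a ≠ 0 := fun q hq => mul_ne_zero_iff.mp (hJ0 _ hq)
  have hzx : ∀ t x : ℝ, HasDerivAt (fun y => t * (y + a)) t x := fun t x => by
    simpa using ((hasDerivAt_id' x).add_const a).const_mul t
  have hzt : ∀ t x : ℝ, HasDerivAt (fun s => s * (x + a)) (x + a) t := fun t x => by
    simpa using (hasDerivAt_id' t).mul_const (x + a)
  have evx : ∀ {t x : ℝ}, (t, x) ∈ Ω → ∀ᶠ y in nhds x, (t, y) ∈ Ω := fun {t x} h =>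
    (Continuous.prodMk_right t).continuousAt.eventually (hΩo.mem_nhds h)
  have evt : ∀ {t x : ℝ}, (t, x) ∈ Ω → ∀ᶠ s in nhds t, (s, x) ∈ Ω := fun {t x} h =>
    (Continuous.prodMk_left x).continuousAt.eventually (hΩo.mem_nhds h)
  have d1 : ∀ t x, (t, x) ∈ Ω → HasDerivAt (fun y => u (t, y)) (t * Y (t * (x + a))) x := by
    intro t x h
    exact ((hd _ h).1.comp x (hzx t x)).congr_deriv (mul_comm _ _)
  have d2 : ∀ t x, (t, x) ∈ Ω → HasDerivAt (fun y => t * Y (t * (y + a)))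
      (t * (g (u (t, x)) - Y (t * (x + a))) / (x + a)) x := by
    intro t x h
    refine (((hd _ h).2.comp x (hzx t x)).const_mul t).congr_deriv ?_
    obtain ⟨h1, h2⟩ := ne _ h
    simp only at h1 h2
    simp only [hu]
    field_simp
  have x1 : ∀ t x, (t, x) ∈ Ω → xDeriv u 1 (t, x) = t * Y (t * (x + a)) := by
    intro t x h
    rw [xDeriv_succ, xDeriv_zero]
    exact (d1 t x h).deriv
  have x2 : ∀ t x, (t, x) ∈ Ω →
      xDeriv u 2 (t, x) = t * (g (u (t, x)) - Y (t * (x + a))) / (x + a) := by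
    intro t x h
    rw [xDeriv_succ, ← (d2 t x h).deriv]
    refine Filter.EventuallyEq.deriv_eq ?_
    filter_upwards [evx h] with y hy using x1 t y hy
  have hmaps : Set.MapsTo u Ω I := fun q hq => hWI hq
  have hsol : IsSolutionOn g I Ω u := by
    refine ⟨hΩo, hW.comp (t := J) (by fun_prop) fun q hq => hq, hmaps, fun t x h => ?_⟩
    have e : (fun s => deriv (fun y => u (s, y)) x) =ᶠ[nhds t] fun s => s * Y (s * (x + a)) := by
      filter_upwards [evt h] with s hs using (d1 s x hs).deriv
    refine (e.deriv_eq.trans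
      ((hasDerivAt_id' t).fun_mul ((hd _ h).2.comp t (hzt t x))).deriv).trans ?_
    obtain ⟨h1, h2⟩ := ne _ h
    simp only at h1 h2
    simp only [hu, Function.comp_apply]
    field_simp
    ring
  have hx₀a : x₀ + a = ρ * β := by rw [ha]; ring
  have hu0 : u (β, x₀) = u₀ := by simp only [hu, hx₀a, hWz]
  have hY0 : Y (β * (x₀ + a)) = κ := by rw [hx₀a, hYz]
  have hβκ : β * κ = p := by rw [hβ]; field_simp
  refine ⟨Ω, u, β, hsol, hmem, hu0, ?_, ?_, ?_, ?_⟩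
  · rw [x1 _ _ hmem, hY0, hβκ]
  · rw [x2 _ _ hmem, hY0, hu0, hx₀a, hκd]
    field_simp
    ring
  · have hgd : HasDerivAt g (deriv g u₀) (u (β, x₀)) := by
      rw [hu0]
      exact ((hg.contDiffAt (hI.mem_nhds hu₀)).differentiableAt (by simp)).hasDerivAt
    have e : (fun y => xDeriv u 2 (β, y)) =ᶠ[nhds x₀]
        fun y => β * (g (u (β, y)) - Y (β * (y + a))) / (y + a) := by
      filter_upwards [evx hmem] with y hy using x2 β y hy
    have h3 := (((hgd.comp x₀ (d1 _ _ hmem)).fun_sub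
      ((hd _ hmem).2.comp x₀ (hzx β x₀))).const_mul β).fun_div
      ((hasDerivAt_id' x₀).add_const a) (ne _ hmem).2
    rw [xDeriv_succ, e.deriv_eq]
    refine h3.deriv.trans ?_
    have hWx : W (β * (x₀ + a)) = u₀ := hu0
    simp only [Function.comp_apply, hu0, hY0, hWx]
    rw [hx₀a, ← hβκ]
    have : g u₀ = κ + ρ * r := by rw [hκd]; ring
    rw [this]
    field_simp
    ring
  · refine ((hd _ hmem).1.comp β (hzt β x₀)).congr_deriv ?_
    simp only
    rw [hY0, hx₀a, ← hβκ]
    ring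

end SimilaritySolutions

/-! ### Determining equations of a second order law -/

section DeterminingEquations

variable {g : ℝ → ℝ} {I : Set ℝ}

/-- Jets `(x, u, u_x, u_xx)` of second order. -/
abbrev Jet₂ : Type := ℝ × (Fin 3 → ℝ)

/-- The direction of the base coordinate `x`. -/
def dirX : Jet₂ := (1, 0)

/-- The direction of the jet coordinate `∂ₓⁱ u`. -/
def dirU (i : Fin 3) : Jet₂ := (0, Pi.single i 1)

lemma jet_eq_sum (a b₀ b₁ b₂ : ℝ) :
    ((a, ![b₀, b₁, b₂]) : Jet₂) = a • dirX + b₀ • dirU 0 + b₁ • dirU 1 + b₂ • dirU 2 := by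
  ext i
  · simp [dirX, dirU]
  · fin_cases i <;> simp [dirX, dirU]

lemma isOpen_jetDomain {q : ℕ} {V : Set (ℝ × (Fin q → ℝ))} (hI : IsOpen I) (hV : IsOpen V) :
    IsOpen (jetDomain I V) :=
  (hI.preimage (by fun_prop : Continuous fun z : ℝ × (Fin (q + 1) → ℝ) => z.2 0)).inter
    (hV.preimage (by fun_prop :
      Continuous fun z : ℝ × (Fin (q + 1) → ℝ) => (z.1, fun i : Fin q => z.2 i.succ)))

lemma xJet_two (u : ℝ × ℝ → ℝ) (t x : ℝ) :
    xJet 2 u t x = (x, ![xDeriv u 0 (t, x), xDeriv u 1 (t, x), xDeriv u 2 (t, x)]) := by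
  ext i
  · rfl
  · fin_cases i <;> rfl

/-- The conservation law along a solution, expanded by the chain rule. -/
lemma IsConservationLaw.fderiv_eq_zero (hI : IsOpen I) (hg : ContDiffOn ℝ ∞ g I)
    {V : Set (ℝ × (Fin 2 → ℝ))} (hV : IsOpen V) {Pt Px : Jet₂ → ℝ}
    (hlaw : IsConservationLaw g I 2 V Pt Px) {Ω : Set (ℝ × ℝ)} {u : ℝ × ℝ → ℝ}
    (hs : IsSolutionOn g I Ω u) {t x u_t : ℝ} (htx : (t, x) ∈ Ω)
    (hjet : xJet 2 u t x ∈ jetDomain I V) (hut : HasDerivAt (fun s => u (s, x)) u_t t) :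
    fderiv ℝ Pt (xJet 2 u t x) (0, ![u_t, g (u (t, x)), deriv g (u (t, x)) * xDeriv u 1 (t, x)]) +
      fderiv ℝ Px (xJet 2 u t x) (1, ![xDeriv u 1 (t, x), xDeriv u 2 (t, x), xDeriv u 3 (t, x)])
        = 0 := by
  have hjo := isOpen_jetDomain hI hV
  have hcont : ContinuousOn (fun z : ℝ × ℝ => xJet 2 u z.1 z.2) Ω := by
    have hx := fun k => (contDiffOn_xDeriv hs.isOpen hs.contDiffOn k).continuousOn
    simp only [xJet_two]
    refine continuousOn_snd.prodMk (continuousOn_pi.mpr fun i => ?_)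
    fin_cases i
    exacts [hx 0, hx 1, hx 2]
  set Ω' := Ω ∩ (fun z : ℝ × ℝ => xJet 2 u z.1 z.2) ⁻¹' jetDomain I V with hΩ'
  have hs' : IsSolutionOn g I Ω' u := ⟨hcont.isOpen_inter_preimage hs.isOpen hjo,
    hs.contDiffOn.mono Set.inter_subset_left, fun z hz => hs.mapsTo hz.1,
    fun t x h => hs.eqn t x h.1⟩
  have hcons := hlaw.conserved Ω' u hs' (fun t x h => h.2) t x ⟨htx, hjet⟩
  have hPt : HasFDerivAt Pt (fderiv ℝ Pt (xJet 2 u t x)) (xJet 2 u t x) :=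
    ((hlaw.contDiffOn_Pt.contDiffAt (hjo.mem_nhds hjet)).differentiableAt (by simp)).hasFDerivAt
  have hPx : HasFDerivAt Px (fderiv ℝ Px (xJet 2 u t x)) (xJet 2 u t x) :=
    ((hlaw.contDiffOn_Px.contDiffAt (hjo.mem_nhds hjet)).differentiableAt (by simp)).hasFDerivAt
  have hux : HasDerivAt (fun y => u (t, y)) (xDeriv u 1 (t, x)) x := by
    simpa only [xDeriv_zero] using hasDerivAt_xDeriv hs.isOpen hs.contDiffOn 0 htx
  have hgd : HasDerivAt g (deriv g (u (t, x))) (u (t, x)) :=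
    ((hg.contDiffAt (hI.mem_nhds (hs.mapsTo htx))).differentiableAt (by simp)).hasDerivAt
  have h2t : HasDerivAt (fun s => xDeriv u 2 (s, x))
      (deriv g (u (t, x)) * xDeriv u 1 (t, x)) t :=
    hasDerivAt_xDeriv_succ_fst hs.isOpen hs.contDiffOn (k := 1) (G := fun z => g (u z))
      (fun z hz => hs.hasDerivAt_xDeriv_one hz) htx (hgd.comp x hux)
  have hJt : HasDerivAt (fun s => xJet 2 u s x)
      (0, ![u_t, g (u (t, x)), deriv g (u (t, x)) * xDeriv u 1 (t, x)]) t := by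
    simp only [xJet_two]
    refine (hasDerivAt_const t x).prodMk (hasDerivAt_pi.mpr fun i => ?_)
    fin_cases i
    · simpa [xDeriv_zero] using hut
    · exact hs.hasDerivAt_xDeriv_one htx
    · exact h2t
  have hJx : HasDerivAt (fun y => xJet 2 u t y)
      (1, ![xDeriv u 1 (t, x), xDeriv u 2 (t, x), xDeriv u 3 (t, x)]) x := by
    simp only [xJet_two]
    refine (hasDerivAt_id' x).prodMk (hasDerivAt_pi.mpr fun i => ?_)
    fin_cases i
    · exact hasDerivAt_xDeriv hs.isOpen hs.contDiffOn 0 htx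
    · exact hasDerivAt_xDeriv hs.isOpen hs.contDiffOn 1 htx
    · exact hasDerivAt_xDeriv hs.isOpen hs.contDiffOn 2 htx
  have e1 := (hPt.comp_hasDerivAt t hJt).deriv
  have e2 := (hPx.comp_hasDerivAt x hJx).deriv
  rw [← e1, ← e2]
  exact hcons

lemma eq_zero_of_quadratic {a b c R : ℝ} (h : ∀ ρ, R ≤ ρ → a * ρ ^ 2 + b * ρ + c = 0) :
    a = 0 ∧ b = 0 ∧ c = 0 := by
  have h0 := h R le_rfl
  have h1 := h (R + 1) (by linarith)
  have h2 := h (R + 2) (by linarith)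
  have ha : a = 0 := by linear_combination (h0 - 2 * h1 + h2) / 2
  subst ha
  have hb : b = 0 := by linear_combination h1 - h0
  subst hb
  exact ⟨rfl, rfl, by linarith⟩

/-- The determining equations of a second order conservation law. -/
lemma IsConservationLaw.determining (hI : IsOpen I) (hg : ContDiffOn ℝ ∞ g I)
    {V : Set (ℝ × (Fin 2 → ℝ))} (hV : IsOpen V) {Pt Px : Jet₂ → ℝ}
    (hlaw : IsConservationLaw g I 2 V Pt Px) {z : Jet₂} (hz : z ∈ jetDomain I V)
    (hp : z.2 1 ≠ 0) (hr : z.2 2 ≠ 0) :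
    fderiv ℝ Pt z (dirU 0) = 0 ∧
      (fderiv ℝ Pt z (dirU 1) * g (z.2 0) + fderiv ℝ Pt z (dirU 2) * z.2 1 * deriv g (z.2 0) +
        fderiv ℝ Px z dirX + z.2 1 * fderiv ℝ Px z (dirU 0) + z.2 2 * fderiv ℝ Px z (dirU 1)) *
          z.2 1 + 2 * z.2 2 ^ 2 * fderiv ℝ Px z (dirU 2) = 0 ∧
      fderiv ℝ Px z (dirU 2) * (deriv g (z.2 0) * z.2 1 ^ 2 - 2 * z.2 2 * g (z.2 0)) = 0 := by
  set p := z.2 1 with hpd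
  set r := z.2 2 with hrd
  set u₀ := z.2 0 with hud
  have hzeq : z = (z.1, ![u₀, p, r]) := by
    ext i
    · rfl
    · fin_cases i <;> rfl
  -- The identity along the similarity solution, multiplied by `ρ p`, is quadratic in `ρ`. The lower
  -- bound on `ρ` ensures `ρ ≠ 0` and `g u₀ ≠ ρ r`.
  have key : ∀ ρ : ℝ, |g u₀ / r| + 1 ≤ ρ →
      (fderiv ℝ Pt z (dirU 0) * p ^ 2) * ρ ^ 2 +
      ((fderiv ℝ Pt z (dirU 1) * g u₀ + fderiv ℝ Pt z (dirU 2) * p * deriv g u₀ +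
        fderiv ℝ Px z dirX + p * fderiv ℝ Px z (dirU 0) + r * fderiv ℝ Px z (dirU 1)) *
          p + 2 * r ^ 2 * fderiv ℝ Px z (dirU 2)) * ρ +
      fderiv ℝ Px z (dirU 2) * (deriv g u₀ * p ^ 2 - 2 * r * g u₀) = 0 := by
    intro ρ hρ
    have hρ0 : ρ ≠ 0 := by have := abs_nonneg (g u₀ / r); intro h; linarith
    have hκ : g u₀ - ρ * r ≠ 0 := by
      intro h
      have : g u₀ / r = ρ := by field_simp; linarith
      have := le_abs_self (g u₀ / r)
      linarith
    obtain ⟨Ω, u, t, hs, hmem, e0, e1, e2, e3, hut⟩ :=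
      exists_similarity_solution hI hg (x₀ := z.1) hz.1 hp hρ0 hκ
    have hjet : xJet 2 u t z.1 = z := by
      rw [xJet_two, xDeriv_zero, e0, e1, e2, ← hzeq]
    have h := hlaw.fderiv_eq_zero hI hg hV hs hmem (by rwa [hjet]) hut
    rw [hjet, e0, e1, e2, e3, jet_eq_sum, jet_eq_sum] at h
    simp only [map_add, map_smul, smul_eq_mul] at h
    field_simp at h
    linear_combination h
  obtain ⟨h2, h1, h0⟩ := eq_zero_of_quadratic key
  exact ⟨(mul_eq_zero.mp h2).resolve_right (pow_ne_zero 2 hp), h1, h0⟩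

end DeterminingEquations

/-! ### Smooth functions on an open set as an algebra with commuting derivations -/

section SmoothFunctions

/-- The extension by zero of a function on a subset. -/
def zeroExt {E : Type*} {D : Set E} (f : D → ℝ) : E → ℝ := Function.extend Subtype.val f 0

lemma zeroExt_coe {E : Type*} {D : Set E} (f : D → ℝ) (z : D) : zeroExt f z = f z :=
  Subtype.val_injective.extend_apply _ _ _

lemma zeroExt_eventuallyEq {E : Type*} [TopologicalSpace E] {D : Set E} (hD : IsOpen D)
    {f : D → ℝ} {F : E → ℝ} (h : ∀ z : D, f z = F z) {z : E} (hz : z ∈ D) : zeroExt f =ᶠ[nhds z] F := by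
  filter_upwards [hD.mem_nhds hz] with y hy
  rw [← h ⟨y, hy⟩]
  exact zeroExt_coe f ⟨y, hy⟩

variable {E : Type*} [NormedAddCommGroup E] [NormedSpace ℝ E] {D : Set E}

variable (D) in
/-- The algebra of smooth functions on a set `D`. -/
def smoothAlg : Subalgebra ℝ (D → ℝ) where
  carrier := {f | ContDiffOn ℝ ∞ (zeroExt f) D}
  mul_mem' {f h} hf hh := (hf.mul hh).congr fun z hz => by
    have e := fun k : D → ℝ => zeroExt_coe k ⟨z, hz⟩
    simp only at e
    rw [e, Pi.mul_apply, e, e]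
  add_mem' {f h} hf hh := (hf.add hh).congr fun z hz => by
    have e := fun k : D → ℝ => zeroExt_coe k ⟨z, hz⟩
    simp only at e
    rw [e, Pi.add_apply, e, e]
  algebraMap_mem' r := (contDiffOn_const (c := r)).congr fun z hz => zeroExt_coe _ ⟨z, hz⟩

/-- The restriction of a smooth function to `D`. -/
def smoothAlg.of (F : E → ℝ) (hF : ContDiffOn ℝ ∞ F D) : smoothAlg D :=
  ⟨fun z => F z, hF.congr fun z hz => zeroExt_coe _ ⟨z, hz⟩⟩

lemma fderiv_zeroExt (hD : IsOpen D) {f : D → ℝ} {F : E → ℝ} (h : ∀ z : D, f z = F z) (z : D) :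
    fderiv ℝ (zeroExt f) z = fderiv ℝ F z :=
  (zeroExt_eventuallyEq hD h z.2).fderiv_eq

lemma smoothAlg.differentiableAt (hD : IsOpen D) (f : smoothAlg D) (z : D) :
    DifferentiableAt ℝ (zeroExt f.1) z :=
  (ContDiffOn.contDiffAt f.2 (hD.mem_nhds z.2)).differentiableAt (by simp)

/-- The derivative in a constant direction, as a derivation. -/
def dirDeriv (hD : IsOpen D) (v : E) : Derivation ℝ (smoothAlg D) (smoothAlg D) :=
  Derivation.mk'
    { toFun := fun f => smoothAlg.of (fun z => fderiv ℝ (zeroExt f.1) z v)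
        (contDiffOn_fderiv_apply hD f.2 v)
      map_add' := fun f h => by
        ext z
        change fderiv ℝ (zeroExt (f + h).1) z v =
          fderiv ℝ (zeroExt f.1) z v + fderiv ℝ (zeroExt h.1) z v
        rw [fderiv_zeroExt hD (F := fun z => zeroExt f.1 z + zeroExt h.1 z) fun z => by
          rw [zeroExt_coe, zeroExt_coe]; rfl]
        rw [fderiv_fun_add (smoothAlg.differentiableAt hD f z) (smoothAlg.differentiableAt hD h z)]
        rfl
      map_smul' := fun c f => by
        ext z
        change fderiv ℝ (zeroExt (c • f).1) z v = c * fderiv ℝ (zeroExt f.1) z v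
        rw [fderiv_zeroExt hD (F := fun z => c • zeroExt f.1 z) fun z => by
          rw [zeroExt_coe]; rfl]
        rw [fderiv_fun_const_smul (smoothAlg.differentiableAt hD f z)]
        rfl }
    fun f h => by
      ext z
      change fderiv ℝ (zeroExt (f * h).1) z v =
        f.1 z * fderiv ℝ (zeroExt h.1) z v + h.1 z * fderiv ℝ (zeroExt f.1) z v
      rw [fderiv_zeroExt hD (F := fun z => zeroExt f.1 z * zeroExt h.1 z) fun z => by
        rw [zeroExt_coe, zeroExt_coe]; rfl]
      rw [fderiv_fun_mul (smoothAlg.differentiableAt hD f z) (smoothAlg.differentiableAt hD h z)]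
      simp [zeroExt_coe]

lemma dirDeriv_apply (hD : IsOpen D) (v : E) (f : smoothAlg D) (z : D) :
    (dirDeriv hD v f).1 z = fderiv ℝ (zeroExt f.1) z v := rfl

lemma dirDeriv_of (hD : IsOpen D) (v : E) (F : E → ℝ) (hF : ContDiffOn ℝ ∞ F D) :
    dirDeriv hD v (smoothAlg.of F hF) =
      smoothAlg.of (fun z => fderiv ℝ F z v) (contDiffOn_fderiv_apply hD hF v) := by
  ext z
  rw [dirDeriv_apply, fderiv_zeroExt hD (f := (smoothAlg.of F hF).1) (F := F) fun _ => rfl]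
  rfl

lemma dirDeriv_comm (hD : IsOpen D) (v w : E) (f : smoothAlg D) :
    dirDeriv hD v (dirDeriv hD w f) = dirDeriv hD w (dirDeriv hD v f) := by
  have hs : ContDiffOn ℝ ∞ (zeroExt f.1) D := f.2
  have hf : f = smoothAlg.of (zeroExt f.1) hs := by
    ext z; exact (zeroExt_coe _ _).symm
  rw [hf, dirDeriv_of, dirDeriv_of, dirDeriv_of, dirDeriv_of]
  ext z
  exact fderiv_fderiv_apply_comm hD hs z.2 w v

end SmoothFunctions

/-! ### Elimination of the flux -/

section DifferentialAlgebra

variable {A : Type*} [CommRing A] [Algebra ℝ A]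

/-- The consequences of the equation `P_p g + P_r p g' + Q_x + p Q_u + r Q_p = 0`, where `P` does
not depend on `u` and `Q` does not depend on `r`. -/
lemma differential_consequences {dx du dp dr : Derivation ℝ A A}
    (rx : ∀ f, dr (dx f) = dx (dr f)) (ru : ∀ f, dr (du f) = du (dr f))
    (rp : ∀ f, dr (dp f) = dp (dr f)) (px : ∀ f, dp (dx f) = dx (dp f))
    (pu : ∀ f, dp (du f) = du (dp f)) {p r g₀ g₁ g₂ P Q : A}
    (xp : dx p = 0) (up : du p = 0) (pp : dp p = 1) (rp' : dr p = 0)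
    (pr : dp r = 0) (rr : dr r = 1)
    (xg₀ : dx g₀ = 0) (pg₀ : dp g₀ = 0) (rg₀ : dr g₀ = 0) (ug₀ : du g₀ = g₁)
    (xg₁ : dx g₁ = 0) (pg₁ : dp g₁ = 0) (rg₁ : dr g₁ = 0) (ug₁ : du g₁ = g₂)
    (pg₂ : dp g₂ = 0) (uP : du P = 0) (rQ : dr Q = 0)
    (E : dp P * g₀ + dr P * p * g₁ + dx Q + p * du Q + r * dp Q = 0) :
    dp (dr (dr P)) * g₀ + dr (dr (dr P)) * p * g₁ = 0 ∧
      (dp (dr (dr P)) = 0 → dr (dr (dr P)) = 0 →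
        3 * dr (dr P) * g₂ = dp (dp (dp (dp P)) - dx (dp (dp (dr P))) -
          r * dp (dp (dp (dr P)))) * g₀) := by
  have Er := congrArg dr E
  simp only [map_add, map_zero, Derivation.leibniz, smul_eq_mul, rx, ru, rp, rQ, rp', rr, rg₀, rg₁,
    mul_zero, zero_add, add_zero, mul_one] at Er
  have Er' : dp (dr P) * g₀ + dr (dr P) * p * g₁ + dp Q = 0 := by linear_combination Er
  have Err := congrArg dr Er'
  simp only [map_add, map_zero, Derivation.leibniz, smul_eq_mul, rp, rQ, rp', rg₀, rg₁,
    mul_zero, zero_add, add_zero] at Err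
  refine ⟨by linear_combination Err, fun hprr hrrr => ?_⟩
  have uPpr : du (dp (dr P)) = 0 := by rw [← pu, ← ru, uP, map_zero, map_zero]
  have uPrr : du (dr (dr P)) = 0 := by rw [← ru, ← ru, uP, map_zero, map_zero]
  -- The `p`-derivative of `E` contains `Q_u + (∂_x + p ∂_u + r ∂_p) Q_p`. Since `Er'` expresses
  -- `Q_p` through `P`, applying the same operator to it isolates `Q_u`.
  have Ep := congrArg dp E
  have Erx := congrArg dx Er'
  have Eru := congrArg du Er'
  have Erp := congrArg dp Er'
  simp only [map_add, map_zero, Derivation.leibniz, smul_eq_mul, px, pu, pp, pr, pg₀, pg₁, hprr,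
    xp, up, xg₀, xg₁, ug₀, ug₁, uPpr, uPrr,
    mul_zero, zero_add, add_zero, mul_one] at Ep Erx Eru Erp
  have Uq : du Q = (dx (dp (dr P)) - dp (dp P) + r * dp (dp (dr P))) * g₀ +
      (p * dx (dr (dr P)) - dr P + r * dr (dr P)) * g₁ + p * p * dr (dr P) * g₂ := by
    linear_combination Ep - Erx - p * Eru - r * Erp
  have Uqp := congrArg dp Uq
  simp only [map_add, map_sub, Derivation.leibniz, smul_eq_mul, px, pu, pp, pr, pg₀, pg₁, pg₂,
    hprr, map_zero, mul_zero, zero_add, add_zero, mul_one] at Uqp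
  -- Equality of the two expressions for `Q_up`, from `Uq` and from the `u`-derivative of `Er'`; `Q`
  -- is now gone.
  have K : (dp (dp (dp P)) - dx (dp (dp (dr P))) - r * dp (dp (dp (dr P)))) * g₀ =
      dx (dr (dr P)) * g₁ + 3 * p * dr (dr P) * g₂ := by
    linear_combination Uqp - Eru
  -- Since `P_prr = 0`, a `p`-derivative kills the `g'` term and leaves `3 P_rr g''`.
  have Kp := congrArg dp K
  have h3 : dp (3 : A) = 0 := by
    have : (3 : A) = algebraMap ℝ A 3 := (map_ofNat (algebraMap ℝ A) 3).symm
    rw [this, Derivation.map_algebraMap]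
  rw [Derivation.leibniz, pg₀] at Kp
  simp only [map_add, Derivation.leibniz, smul_eq_mul, px, pp, pg₁, pg₂, h3,
    hprr, map_zero, mul_zero, zero_add, add_zero, mul_one] at Kp
  linear_combination -Kp

end DifferentialAlgebra

/-! ### Functions that do not depend on `u` -/

section FiberInvariance

/-- `F` takes the same value at jets in `D` that differ only in the coordinate `u`. -/
def FiberInvariant (D : Set Jet₂) (F : Jet₂ → ℝ) : Prop :=
  ∀ z ∈ D, ∀ z' ∈ D, z.1 = z'.1 → z.2 1 = z'.2 1 → z.2 2 = z'.2 2 → F z = F z'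

variable {D : Set Jet₂} {F G : Jet₂ → ℝ}

lemma FiberInvariant.congr (hF : FiberInvariant D F) (h : Set.EqOn G F D) :
    FiberInvariant D G := fun z hz z' hz' h0 h1 h2 => by
  rw [h hz, h hz', hF z hz z' hz' h0 h1 h2]

/-- Near `z` the function agrees with its translate by `z' - z`, so the whole derivative is the same
at both points. -/
lemma FiberInvariant.fderiv (hD : IsOpen D) (hF : FiberInvariant D F) (v : Jet₂) :
    FiberInvariant D fun z => fderiv ℝ F z v := by
  intro z hz z' hz' h0 h1 h2
  have hz'' : z' = z + (z' - z) := by abel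
  have e : (fun y => F (y + (z' - z))) =ᶠ[nhds z] F := by
    have hc : ContinuousAt (fun y : Jet₂ => y + (z' - z)) z := by fun_prop
    have hev : ∀ᶠ y in nhds z, y + (z' - z) ∈ D :=
      hc.eventually (by
        change ∀ᶠ y in nhds (z + (z' - z)), y ∈ D
        rw [← hz'']
        exact hD.mem_nhds hz')
    filter_upwards [hev, hD.mem_nhds hz] with y hy hy'
    exact hF _ hy _ hy' (by simp [h0]) (by simp [h1]) (by simp [h2])
  have : _root_.fderiv ℝ F z' = _root_.fderiv ℝ F z := by
    rw [← e.fderiv_eq, fderiv_comp_add_right, ← hz'']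
  simp only [this]

lemma zeroExt_of_mem (f : D → ℝ) {z : Jet₂} (hz : z ∈ D) : zeroExt f z = f ⟨z, hz⟩ :=
  zeroExt_coe f ⟨z, hz⟩

lemma fiberInvariant_sub {f h : smoothAlg D} (hf : FiberInvariant D (zeroExt f.1))
    (hh : FiberInvariant D (zeroExt h.1)) : FiberInvariant D (zeroExt (f - h).1) := by
  intro z hz z' hz' h0 h1 h2
  have ef := hf z hz z' hz' h0 h1 h2
  have eh := hh z hz z' hz' h0 h1 h2
  rw [zeroExt_of_mem _ hz, zeroExt_of_mem _ hz'] at ef eh ⊢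
  change f.1 _ - h.1 _ = f.1 _ - h.1 _
  rw [ef, eh]

lemma fiberInvariant_mul {f h : smoothAlg D} (hf : FiberInvariant D (zeroExt f.1))
    (hh : FiberInvariant D (zeroExt h.1)) : FiberInvariant D (zeroExt (f * h).1) := by
  intro z hz z' hz' h0 h1 h2
  have ef := hf z hz z' hz' h0 h1 h2
  have eh := hh z hz z' hz' h0 h1 h2
  rw [zeroExt_of_mem _ hz, zeroExt_of_mem _ hz'] at ef eh ⊢
  change f.1 _ * h.1 _ = f.1 _ * h.1 _
  rw [ef, eh]

lemma fiberInvariant_dirDeriv (hD : IsOpen D) {f : smoothAlg D}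
    (hf : FiberInvariant D (zeroExt f.1)) (v : Jet₂) :
    FiberInvariant D (zeroExt (dirDeriv hD v f).1) :=
  (hf.fderiv hD v).congr fun z hz => zeroExt_coe _ ⟨z, hz⟩

end FiberInvariance

/-! ### The leading coefficient of the multiplier of a second order law -/

section TopCoefficient

/-- `F` depends only on `x, u, u_x, u_xx`. -/
def DependsOnJet₂ (F : DiffFun) : Prop := ∀ x w w', (∀ i < 3, w i = w' i) → F x w = F x w'

lemma DependsOnJet₂.jetDeriv {F : DiffFun} (hF : DependsOnJet₂ F) {k : ℕ} (hk : k < 3) :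
    DependsOnJet₂ (jetDeriv k F) := by
  intro x w w' h
  have e : (fun s => F x (Function.update w k s)) = fun s => F x (Function.update w' k s) := by
    ext s
    refine hF x _ _ fun i hi => ?_
    by_cases hik : i = k
    · subst hik; simp
    · simp [hik, h i hi]
  simp only [KleinGordon.jetDeriv, e, h k hk]

lemma DependsOnJet₂.jetDeriv_eq_zero {F : DiffFun} (hF : DependsOnJet₂ F) {k : ℕ} (hk : 3 ≤ k)
    (x : ℝ) (w : ℕ → ℝ) : KleinGordon.jetDeriv k F x w = 0 := by
  have e : (fun s => F x (Function.update w k s)) = fun _ => F x w := by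
    ext s
    exact hF x _ _ fun i hi => Function.update_of_ne (by omega) _ _
  simp [KleinGordon.jetDeriv, e]

lemma dependsOnJet₂_toDiffFun (P : Jet₂ → ℝ) : DependsOnJet₂ (toDiffFun (q := 2) P) := by
  intro x w w' h
  simp only [toDiffFun]
  congr 2
  ext i
  exact h i i.2

/-- The multiplier is affine in `u_xxx`, which enters only through the term `u_xxx ∂/∂u_xx` of `D_x`
acting on `∂P/∂u_xx`. -/
lemma jetDeriv_three_multiplier (P : Jet₂ → ℝ) (x : ℝ) (w : ℕ → ℝ) :
    jetDeriv 3 (multiplier (q := 2) P) x w =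
      -jetDeriv 2 (jetDeriv 2 (toDiffFun (q := 2) P)) x w := by
  set F : DiffFun := toDiffFun (q := 2) P with hFd
  have hF : DependsOnJet₂ F := dependsOnJet₂_toDiffFun P
  set G := jetDeriv 2 F with hGd
  have hG : DependsOnJet₂ G := hF.jetDeriv (by norm_num)
  have hupd : ∀ s, ∀ i < 3, Function.update w 3 s i = w i := fun s i hi =>
    Function.update_of_ne (by omega) _ _
  have key : ∀ s, multiplier (q := 2) P x (Function.update w 3 s) =
      (jetDeriv 1 F x w - (deriv (fun y => G y w) x + w 1 * jetDeriv 0 G x w +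
        w 2 * jetDeriv 1 G x w)) - s * jetDeriv 2 G x w := by
    intro s
    have hsub : (Function.support fun k => Function.update w 3 s (k + 1) *
        jetDeriv k G x (Function.update w 3 s)) ⊆ (Finset.range 3 : Finset ℕ) := by
      intro k hk
      by_contra hn
      apply hk
      simp only [hG.jetDeriv_eq_zero (k := k) (by simpa using hn), mul_zero]
    have hGy : (fun y => G y (Function.update w 3 s)) = fun y => G y w := by
      ext y; exact hG y _ _ (hupd s)
    simp only [multiplier, Finset.sum_range_succ, Finset.sum_range_zero, Function.iterate_zero,
      id_eq, Function.iterate_one, zero_add, Pi.neg_apply, one_add_one_eq_two]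
    rw [← hFd, ← hGd, totalDx, finsum_eq_sum_of_support_subset _ hsub, hGy,
      (hF.jetDeriv (by norm_num : 1 < 3)) x _ _ (hupd s)]
    simp only [Finset.sum_range_succ, Finset.sum_range_zero, zero_add, one_add_one_eq_two]
    rw [(hG.jetDeriv (by norm_num : 0 < 3)) x _ _ (hupd s),
      (hG.jetDeriv (by norm_num : 1 < 3)) x _ _ (hupd s),
      (hG.jetDeriv (by norm_num : 2 < 3)) x _ _ (hupd s), hupd s 1 (by norm_num),
      hupd s 2 (by norm_num), Function.update_self]
    ring
  rw [jetDeriv]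
  simp only [key]
  have := ((hasDerivAt_id' (w 3)).mul_const (jetDeriv 2 G x w)).const_sub
    (jetDeriv 1 F x w - (deriv (fun y => G y w) x + w 1 * jetDeriv 0 G x w +
        w 2 * jetDeriv 1 G x w))
  rw [this.deriv, one_mul]

lemma jetDeriv_two_toDiffFun {D : Set Jet₂} (hD : IsOpen D) {P : Jet₂ → ℝ}
    (hP : ContDiffOn ℝ ∞ P D) {x : ℝ} {w : ℕ → ℝ} (h : ((x, fun i => w i) : Jet₂) ∈ D) :
    jetDeriv 2 (toDiffFun (q := 2) P) x w = fderiv ℝ P (x, fun i => w i) (dirU 2) := by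
  have hd : HasFDerivAt P (fderiv ℝ P (x, fun i => w i)) (x, fun i => w i) :=
    ((hP.contDiffAt (hD.mem_nhds h)).differentiableAt (by simp)).hasFDerivAt
  have hγ : HasDerivAt (fun s => ((x, fun i : Fin 3 => Function.update w 2 s i) : Jet₂))
      (dirU 2) (w 2) := by
    refine (hasDerivAt_const _ x).prodMk (hasDerivAt_pi.mpr fun i => ?_)
    fin_cases i
    · simpa using hasDerivAt_const (w 2) (w 0)
    · simpa using hasDerivAt_const (w 2) (w 1)
    · simpa using hasDerivAt_id' (w 2)
  have hγ0 : ((x, fun i : Fin 3 => Function.update w 2 (w 2) i) : Jet₂) =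
      ((x, fun i => w i) : Jet₂) := by
    simp
  rw [← hγ0] at hd
  have := (hd.comp_hasDerivAt (w 2) hγ).deriv
  rw [hγ0] at this
  exact this

lemma jetDeriv_two_jetDeriv_two {D : Set Jet₂} (hD : IsOpen D) {P : Jet₂ → ℝ}
    (hP : ContDiffOn ℝ ∞ P D) {x : ℝ} {w : ℕ → ℝ} (h : ((x, fun i => w i) : Jet₂) ∈ D) :
    jetDeriv 2 (jetDeriv 2 (toDiffFun (q := 2) P)) x w =
      fderiv ℝ (fun z => fderiv ℝ P z (dirU 2)) (x, fun i => w i) (dirU 2) := by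
  rw [← jetDeriv_two_toDiffFun hD (contDiffOn_fderiv_apply hD hP (dirU 2)) h]
  refine Filter.EventuallyEq.deriv_eq ?_
  have hc : ContinuousAt
      (fun s => ((x, fun i : Fin 3 => Function.update w 2 s i) : Jet₂)) (w 2) := by
    refine continuousAt_const.prodMk (continuousAt_pi.mpr fun i => ?_)
    fin_cases i
    · simpa using continuousAt_const
    · simpa using continuousAt_const
    · simpa using (continuousAt_id' (w 2))
  have hev : ∀ᶠ s in nhds (w 2), ((x, fun i : Fin 3 => Function.update w 2 s i) : Jet₂) ∈ D :=
    hc.eventually (hD.mem_nhds (by simpa using h))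
  filter_upwards [hev] with s hs
  exact jetDeriv_two_toDiffFun hD hP hs

end TopCoefficient

/-! ### A law of order two forces `g'' = c g` -/

section Necessity

variable {g : ℝ → ℝ} {I : Set ℝ}

/-- If the equation failed at a point, it would fail on a neighbourhood; there `g` would vanish
identically, and then so would `g''`. -/
lemma forall_of_forall_ne_zero (hI : IsOpen I) (hg : ContDiffOn ℝ ∞ g I) {c : ℝ}
    (h : ∀ v ∈ I, g v ≠ 0 → deriv (deriv g) v = c * g v) :
    ∀ v ∈ I, deriv (deriv g) v = c * g v := by
  intro v hv
  have hg' : ContDiffOn ℝ ∞ (deriv g) I := ((contDiffOn_infty_iff_deriv_of_isOpen hI).mp hg).2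
  have hg'' : ContDiffOn ℝ ∞ (deriv (deriv g)) I :=
    ((contDiffOn_infty_iff_deriv_of_isOpen hI).mp hg').2
  by_contra hne
  have hc : ContinuousAt (fun v => deriv (deriv g) v - c * g v) v :=
    (hg''.continuousOn.continuousAt (hI.mem_nhds hv)).sub
      (continuousAt_const.mul (hg.continuousOn.continuousAt (hI.mem_nhds hv)))
  have hev : ∀ᶠ s in nhds v, g s = 0 := by
    filter_upwards [hc.eventually_ne (sub_ne_zero.mpr hne), hI.mem_nhds hv] with s hs hsI
    by_contra hgs
    exact hs (sub_eq_zero.mpr (h s hsI hgs))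
  have hev0 : g =ᶠ[nhds v] fun _ => 0 := hev
  apply hne
  rw [hev0.deriv.deriv_eq, hev.self_of_nhds]
  simp

lemma deriv_deriv_of_deriv (hI : IsOpen I) (hg : ContDiffOn ℝ ∞ g I) {k : ℝ}
    (h : ∀ v ∈ I, g v ≠ 0 → deriv g v = k * g v) :
    ∀ v ∈ I, g v ≠ 0 → deriv (deriv g) v = k ^ 2 * g v := by
  intro v hv hgv
  have hgc : ContinuousAt g v := hg.continuousOn.continuousAt (hI.mem_nhds hv)
  have e : deriv g =ᶠ[nhds v] fun s => k * g s := by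
    filter_upwards [hgc.eventually_ne hgv, hI.mem_nhds hv] with s hs hsI using h s hsI hs
  have hd : DifferentiableAt ℝ g v :=
    (hg.contDiffAt (hI.mem_nhds hv)).differentiableAt (by simp)
  rw [e.deriv_eq, deriv_const_mul _ hd, h v hv hgv]
  ring

/-- The order condition gives a jet with `P_rr ≠ 0`; by continuity a small shift of `u_x` and `u_xx`
keeps this and avoids their zeros, where the determining equations are not available. -/
lemma IsConservationLaw.exists_fderiv_fderiv_ne_zero (hI : IsOpen I)
    {V : Set (ℝ × (Fin 2 → ℝ))} (hV : IsOpen V) {Pt Px : Jet₂ → ℝ}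
    (hlaw : IsConservationLaw g I 2 V Pt Px) :
    ∃ z ∈ jetDomain I V, z.2 1 ≠ 0 ∧ z.2 2 ≠ 0 ∧
      fderiv ℝ (fun z => fderiv ℝ Pt z (dirU 2)) z (dirU 2) ≠ 0 := by
  have hjo : IsOpen (jetDomain I V) := isOpen_jetDomain hI hV
  obtain ⟨n, hn, ⟨x, w, hw, hne⟩, -⟩ := hlaw.order
  obtain rfl : n = 3 := by omega
  rw [jetDeriv_three_multiplier, jetDeriv_two_jetDeriv_two hjo hlaw.contDiffOn_Pt hw,
    neg_ne_zero] at hne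
  set z : Jet₂ := (x, fun i => w i) with hz
  have hγ : ContinuousAt (fun s : ℝ => z + s • (dirU 1 + dirU 2)) 0 := by fun_prop
  have hγ0 : z + (0 : ℝ) • (dirU 1 + dirU 2) = z := by simp
  have hc : ContinuousAt (fun y => fderiv ℝ (fun z => fderiv ℝ Pt z (dirU 2)) y (dirU 2)) z :=
    (contDiffOn_fderiv_apply hjo (contDiffOn_fderiv_apply hjo hlaw.contDiffOn_Pt
      (dirU 2)) (dirU 2)).continuousOn.continuousAt (hjo.mem_nhds hw)
  have hev : ∀ᶠ s in nhds (0 : ℝ), z + s • (dirU 1 + dirU 2) ∈ jetDomain I V ∧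
      fderiv ℝ (fun z => fderiv ℝ Pt z (dirU 2)) (z + s • (dirU 1 + dirU 2)) (dirU 2) ≠ 0 := by
    refine hγ.eventually (p := fun y => y ∈ jetDomain I V ∧
      fderiv ℝ (fun z => fderiv ℝ Pt z (dirU 2)) y (dirU 2) ≠ 0) ?_
    beta_reduce
    rw [hγ0]
    exact Filter.Eventually.and (hjo.mem_nhds hw) (hc.eventually_ne hne)
  have hne0 : ∀ a : ℝ, ∀ᶠ s in nhdsWithin (0 : ℝ) {0}ᶜ, a + s ≠ 0 := by
    intro a
    by_cases ha : a = 0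
    · subst ha
      filter_upwards [self_mem_nhdsWithin] with s hs
      simpa using hs
    · have hca : ContinuousAt (fun s : ℝ => a + s) 0 := by fun_prop
      exact (hca.eventually_ne (by simpa using ha)).filter_mono nhdsWithin_le_nhds
  obtain ⟨s, ⟨hsD, hsne⟩, h1, h2⟩ := ((hev.filter_mono nhdsWithin_le_nhds).and
    ((hne0 (z.2 1)).and (hne0 (z.2 2)))).exists
  exact ⟨_, hsD, by simpa [dirU] using h1, by simpa [dirU] using h2, hsne⟩

/-- The jet `z` with its coordinate `u` replaced by `v`. -/
def setU (z : Jet₂) (v : ℝ) : Jet₂ := (z.1, ![v, z.2 1, z.2 2])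

lemma setU_mem_jetDomain {V : Set (ℝ × (Fin 2 → ℝ))} {z : Jet₂} (hz : z ∈ jetDomain I V) {v : ℝ}
    (hv : v ∈ I) : setU z v ∈ jetDomain I V := by
  refine ⟨hv, ?_⟩
  have h : (fun i : Fin 2 => (setU z v).2 i.succ) = fun i : Fin 2 => z.2 i.succ := by
    ext i
    fin_cases i <;> rfl
  change (z.1, fun i : Fin 2 => (setU z v).2 i.succ) ∈ V
  rw [h]
  exact hz.2

lemma hasDerivAt_setU (z : Jet₂) (v : ℝ) : HasDerivAt (setU z) (dirU 0) v := by
  refine (hasDerivAt_const _ _).prodMk (hasDerivAt_pi.mpr fun i => ?_)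
  fin_cases i
  · simpa using hasDerivAt_id' v
  · simpa using hasDerivAt_const v (z.2 1)
  · simpa using hasDerivAt_const v (z.2 2)

/-- Only equations with `g'' = c g` have a conservation law of order two. -/
theorem IsConservationLaw.exists_deriv_deriv_eq (hI : IsOpen I) (hI' : I.OrdConnected)
    (hg : ContDiffOn ℝ ∞ g I) {V : Set (ℝ × (Fin 2 → ℝ))} (hV : IsOpen V) {Pt Px : Jet₂ → ℝ}
    (hlaw : IsConservationLaw g I 2 V Pt Px) : ∃ c, ∀ v ∈ I, deriv (deriv g) v = c * g v := by
  by_cases hO : ∀ v ∈ I, g v = 0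
  · exact ⟨0, forall_of_forall_ne_zero hI hg fun v hv hgv => absurd (hO v hv) hgv⟩
  push Not at hO
  obtain ⟨v₀, hv₀, hgv₀⟩ := hO
  have hjo : IsOpen (jetDomain I V) := isOpen_jetDomain hI hV
  set D₀ : Set Jet₂ := {z | z ∈ jetDomain I V ∧ z.2 1 ≠ 0 ∧ z.2 2 ≠ 0} with hD₀
  have hD₀o : IsOpen D₀ := hjo.inter ((isOpen_ne.preimage (by fun_prop : Continuous
    fun z : Jet₂ => z.2 1)).inter (isOpen_ne.preimage (by fun_prop : Continuous
    fun z : Jet₂ => z.2 2)))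
  set D : Set Jet₂ := {z | z ∈ D₀ ∧ g (z.2 0) ≠ 0} with hDdef
  have hgc : ContinuousOn (fun z : Jet₂ => g (z.2 0)) D₀ :=
    hg.continuousOn.comp (by fun_prop) fun z hz => hz.1.1
  have hD : IsOpen D := hgc.isOpen_inter_preimage hD₀o isOpen_ne
  have hDD₀ : D ⊆ D₀ := fun z hz => hz.1
  have hset : ∀ z ∈ D₀, ∀ v ∈ I, setU z v ∈ D₀ := fun z hz v hv =>
    ⟨setU_mem_jetDomain hz.1 hv, hz.2⟩
  have hPt₀ : ContDiffOn ℝ ∞ Pt D₀ := hlaw.contDiffOn_Pt.mono fun z hz => hz.1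
  have hPt : ContDiffOn ℝ ∞ Pt D := hPt₀.mono hDD₀
  have hPx : ContDiffOn ℝ ∞ Px D := hlaw.contDiffOn_Px.mono fun z hz => hz.1.1
  have hdet := fun (z : Jet₂) (hz : z ∈ D₀) => hlaw.determining hI hg hV hz.1 hz.2.1 hz.2.2
  -- Invariance is proved on `D₀`, whose fibres in `u` are the whole interval `I`. The fibres of `D`
  -- omit the zeros of `g` and may be disconnected, and the same `c` is needed on all components.
  have hinv₀ : FiberInvariant D₀ Pt := by
    intro z hz z' hz' h0 h1 h2
    have hself : ∀ z : Jet₂, setU z (z.2 0) = z := fun z => by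
      ext i
      · rfl
      · fin_cases i <;> rfl
    have hz'' : setU z (z'.2 0) = z' := by
      rw [← hself z']
      simp only [setU, h0, h1, h2]
      rfl
    have hder : ∀ v ∈ I, HasDerivAt (fun v => Pt (setU z v)) 0 v := by
      intro v hv
      have hm := hset z hz v hv
      have hd := ((hPt₀.contDiffAt (hD₀o.mem_nhds hm)).differentiableAt (by simp)).hasFDerivAt
      have := hd.comp_hasDerivAt v (hasDerivAt_setU z v)
      rwa [(hdet _ hm).1] at this
    have := hI.is_const_of_deriv_eq_zero hI'.isPreconnected
      (fun s hs => (hder s hs).differentiableAt.differentiableWithinAt)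
      (fun s hs => (hder s hs).deriv) hz.1.1 hz'.1.1
    rwa [hself, hz''] at this
  -- Where `Q_r ≠ 0`, the factor `g' p² - 2 r g` must vanish. A small shift of `r` keeps `Q_r ≠ 0`
  -- but changes this factor, because `g ≠ 0`.
  have hQr : ∀ z ∈ D, fderiv ℝ Px z (dirU 2) = 0 := by
    intro z hz
    by_contra hne
    have hγ : ContinuousAt (fun s : ℝ => z + s • dirU 2) 0 := by fun_prop
    have hγ0 : z + (0 : ℝ) • dirU 2 = z := by simp
    have hc : ContinuousAt (fun y => fderiv ℝ Px y (dirU 2)) z :=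
      (contDiffOn_fderiv_apply hD hPx (dirU 2)).continuousOn.continuousAt (hD.mem_nhds hz)
    have hev : ∀ᶠ s in nhds (0 : ℝ), z + s • dirU 2 ∈ D ∧
        fderiv ℝ Px (z + s • dirU 2) (dirU 2) ≠ 0 := by
      refine hγ.eventually (p := fun y => y ∈ D ∧ fderiv ℝ Px y (dirU 2) ≠ 0) ?_
      beta_reduce
      rw [hγ0]
      exact Filter.Eventually.and (hD.mem_nhds hz) (hc.eventually_ne hne)
    obtain ⟨s, ⟨hsD, hsne⟩, hs0⟩ :=
      ((hev.filter_mono nhdsWithin_le_nhds).and (self_mem_nhdsWithin :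
        {(0 : ℝ)}ᶜ ∈ nhdsWithin (0 : ℝ) {0}ᶜ)).exists
    have e1 := (mul_eq_zero.mp (hdet z hz.1).2.2).resolve_left hne
    have e2 := (mul_eq_zero.mp (hdet _ hsD.1).2.2).resolve_left hsne
    simp [dirU] at e2
    have : s * g (z.2 0) = 0 := by linear_combination (e1 - e2) / 2
    rcases mul_eq_zero.mp this with h | h
    · exact hs0 h
    · exact hz.2 h
  have hDI : Set.MapsTo (fun z : Jet₂ => z.2 0) D I := fun z hz => hz.1.1.1
  have hg' : ContDiffOn ℝ ∞ (deriv g) I := ((contDiffOn_infty_iff_deriv_of_isOpen hI).mp hg).2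
  have hg'' : ContDiffOn ℝ ∞ (deriv (deriv g)) I :=
    ((contDiffOn_infty_iff_deriv_of_isOpen hI).mp hg').2
  have hcs : ∀ f : ℝ → ℝ, ContDiffOn ℝ ∞ f I → ContDiffOn ℝ ∞ (fun z : Jet₂ => f (z.2 0)) D :=
    fun f hf => hf.comp (by fun_prop) hDI
  have hco : ∀ i : Fin 3, ContDiffOn ℝ ∞ (fun z : Jet₂ => z.2 i) D := fun i => by fun_prop
  have fco : ∀ (i : Fin 3) (z v : Jet₂), fderiv ℝ (fun z : Jet₂ => z.2 i) z v = v.2 i := by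
    intro i z v
    have : HasFDerivAt (fun z : Jet₂ => z.2 i) ((ContinuousLinearMap.proj i).comp
      (ContinuousLinearMap.snd ℝ ℝ (Fin 3 → ℝ))) z :=
      ((ContinuousLinearMap.proj i).comp (ContinuousLinearMap.snd ℝ ℝ (Fin 3 → ℝ))).hasFDerivAt
    rw [this.fderiv]
    rfl
  have fcs : ∀ f : ℝ → ℝ, ContDiffOn ℝ ∞ f I → ∀ z ∈ D, ∀ v : Jet₂,
      fderiv ℝ (fun z : Jet₂ => f (z.2 0)) z v = deriv f (z.2 0) * v.2 0 := by
    intro f hf z hz v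
    have h1 : HasFDerivAt (fun z : Jet₂ => z.2 0) ((ContinuousLinearMap.proj (0 : Fin 3)).comp
      (ContinuousLinearMap.snd ℝ ℝ (Fin 3 → ℝ))) z :=
      ((ContinuousLinearMap.proj (0 : Fin 3)).comp
        (ContinuousLinearMap.snd ℝ ℝ (Fin 3 → ℝ))).hasFDerivAt
    have h2 : HasDerivAt f (deriv f (z.2 0)) (z.2 0) :=
      ((hf.contDiffAt (hI.mem_nhds (hDI hz))).differentiableAt (by simp)).hasDerivAt
    have h3 := h2.comp_hasFDerivAt z h1
    rw [show (fun z : Jet₂ => f (z.2 0)) = f ∘ fun z : Jet₂ => z.2 0 from rfl, h3.fderiv]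
    simp
  have dco : ∀ (i : Fin 3) (v : Jet₂), dirDeriv hD v (smoothAlg.of _ (hco i)) =
      algebraMap ℝ _ (v.2 i) := by
    intro i v
    rw [dirDeriv_of]
    ext z
    exact fco i z v
  have dcs0 : ∀ (f : ℝ → ℝ) (hf : ContDiffOn ℝ ∞ f I) (v : Jet₂), v.2 0 = 0 →
      dirDeriv hD v (smoothAlg.of _ (hcs f hf)) = 0 := by
    intro f hf v hv
    rw [dirDeriv_of]
    ext z
    exact (fcs f hf z z.2 v).trans (by rw [hv, mul_zero]; rfl)
  have dcs1 : ∀ (f : ℝ → ℝ) (hf : ContDiffOn ℝ ∞ f I) (hf' : ContDiffOn ℝ ∞ (deriv f) I),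
      dirDeriv hD (dirU 0) (smoothAlg.of _ (hcs f hf)) = smoothAlg.of _ (hcs _ hf') := by
    intro f hf hf'
    rw [dirDeriv_of]
    ext z
    exact (fcs f hf z z.2 _).trans (by simp [dirU, smoothAlg.of])
  set P := smoothAlg.of Pt hPt with hP
  set Q := smoothAlg.of Px hPx with hQ
  set dp := dirDeriv hD (dirU 1) with hdp
  set dr := dirDeriv hD (dirU 2) with hdr
  set dx := dirDeriv hD dirX with hdx
  set r := smoothAlg.of _ (hco 2) with hrdef
  have huP : dirDeriv hD (dirU 0) P = 0 := by
    rw [hP, dirDeriv_of]; ext z; exact (hdet _ z.2.1).1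
  have hrQ : dr Q = 0 := by
    rw [hQ, hdr, dirDeriv_of]; ext z; exact hQr _ z.2
  have hE : dp P * smoothAlg.of _ (hcs g hg) +
      dr P * smoothAlg.of _ (hco 1) * smoothAlg.of _ (hcs _ hg') + dx Q +
      smoothAlg.of _ (hco 1) * dirDeriv hD (dirU 0) Q + r * dp Q = 0 := by
    rw [hP, hQ, hdp, hdr, hdx]
    simp only [dirDeriv_of]
    ext z
    have h := (hdet z.1 z.2.1).2.1
    rw [hQr z.1 z.2, mul_zero, add_zero] at h
    exact (mul_eq_zero.mp h).resolve_right z.2.1.2.1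
  obtain ⟨hcubic, hfinal⟩ := differential_consequences (g₂ := smoothAlg.of _ (hcs _ hg''))
    (fun f => dirDeriv_comm hD (dirU 2) dirX f) (fun f => dirDeriv_comm hD (dirU 2) (dirU 0) f)
    (fun f => dirDeriv_comm hD (dirU 2) (dirU 1) f) (fun f => dirDeriv_comm hD (dirU 1) dirX f)
    (fun f => dirDeriv_comm hD (dirU 1) (dirU 0) f)
    (by rw [dco]; simp [dirX]) (by rw [dco]; simp [dirU]) (by rw [dco]; simp [dirU])
    (by rw [dco]; simp [dirU]) (by rw [dco]; simp [dirU]) (by rw [dco]; simp [dirU])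
    (dcs0 g hg _ (by simp [dirX])) (dcs0 g hg _ (by simp [dirU])) (dcs0 g hg _ (by simp [dirU]))
    (dcs1 g hg hg') (dcs0 _ hg' _ (by simp [dirX])) (dcs0 _ hg' _ (by simp [dirU]))
    (dcs0 _ hg' _ (by simp [dirU])) (dcs1 _ hg' hg'') (dcs0 _ hg'' _ (by simp [dirU]))
    huP hrQ hE
  have hinvP : FiberInvariant D (zeroExt P.1) := by
    have : FiberInvariant D Pt := fun z hz z' hz' => hinv₀ z hz.1 z' hz'.1
    exact this.congr fun z hz => zeroExt_coe _ ⟨z, hz⟩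
  have hmove : ∀ z ∈ D₀, ∀ v ∈ I, g v ≠ 0 → setU z v ∈ D := fun z hz v hv hgv =>
    ⟨hset z hz v hv, hgv⟩
  have hconst : ∀ f : smoothAlg D, FiberInvariant D (zeroExt f.1) → ∀ (z : Jet₂) (hz : z ∈ D)
      (v : ℝ) (hz' : setU z v ∈ D), f.1 ⟨setU z v, hz'⟩ = f.1 ⟨z, hz⟩ := by
    intro f hf z hz v hz'
    have := hf _ hz' _ hz rfl rfl rfl
    rwa [zeroExt_of_mem _ hz', zeroExt_of_mem _ hz] at this
  -- Either `P` is quadratic in `r` with `P_rr` independent of `p`, infinitesimally, and `3 P_rr g''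
  -- = K g` applies, or the relation `P_prr g + P_rrr p g' = 0` is nontrivial at some jet.
  by_cases hcase : dp (dr (dr P)) = 0 ∧ dr (dr (dr P)) = 0
  · have hf := hfinal hcase.1 hcase.2
    set K := dp (dp (dp (dp P)) - dx (dp (dp (dr P))) - r * dp (dp (dp (dr P)))) with hK
    have inv := fun {f : smoothAlg D} (hf : FiberInvariant D (zeroExt f.1)) v =>
      fiberInvariant_dirDeriv hD hf v
    have hinvr : FiberInvariant D (zeroExt r.1) := by
      have : FiberInvariant D fun z => z.2 2 := fun z _ z' _ _ _ h => h
      exact this.congr fun z hz => zeroExt_coe _ ⟨z, hz⟩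
    have hinvK : FiberInvariant D (zeroExt K.1) :=
      inv (fiberInvariant_sub (fiberInvariant_sub (inv (inv (inv hinvP _) _) _)
        (inv (inv (inv (inv hinvP _) _) _) _))
        (fiberInvariant_mul hinvr (inv (inv (inv (inv hinvP _) _) _) _))) _
    obtain ⟨z₁, hz₁, hp₁, hr₁, hne⟩ := hlaw.exists_fderiv_fderiv_ne_zero hI hV
    have hz₁D : z₁ ∈ D₀ := ⟨hz₁, hp₁, hr₁⟩
    set z₂ := setU z₁ v₀ with hz₂
    have hz₂D : z₂ ∈ D := hmove z₁ hz₁D v₀ hv₀ hgv₀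
    have hne₂ : (dr (dr P)).1 ⟨z₂, hz₂D⟩ ≠ 0 := by
      rw [hdr, hP, dirDeriv_of, dirDeriv_of]
      change fderiv ℝ (fun z => fderiv ℝ Pt z (dirU 2)) z₂ (dirU 2) ≠ 0
      have e := ((hinv₀.fderiv hD₀o (dirU 2)).fderiv hD₀o (dirU 2)) z₂ hz₂D.1 z₁ hz₁D rfl rfl rfl
      exact fun h => hne (e.symm.trans h)
    refine ⟨K.1 ⟨z₂, hz₂D⟩ / (3 * (dr (dr P)).1 ⟨z₂, hz₂D⟩),
      forall_of_forall_ne_zero hI hg fun v hv hgv => ?_⟩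
    have hm : setU z₂ v ∈ D := hmove z₂ hz₂D.1 v hv hgv
    have e := congrArg (fun f : smoothAlg D => f.1 ⟨setU z₂ v, hm⟩) hf
    change 3 * (dr (dr P)).1 ⟨setU z₂ v, hm⟩ * deriv (deriv g) v =
      K.1 ⟨setU z₂ v, hm⟩ * g v at e
    rw [hconst _ (inv (inv hinvP _) _) z₂ hz₂D v hm, hconst _ hinvK z₂ hz₂D v hm] at e
    field_simp
    linear_combination e
  · have hex : ∃ z : D, ¬((dp (dr (dr P))).1 z = 0 ∧ (dr (dr (dr P))).1 z = 0) := by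
      by_contra hall
      push Not at hall
      apply hcase
      constructor
      · ext z; exact (hall z).1
      · ext z; exact (hall z).2
    obtain ⟨⟨z, hz⟩, hne⟩ := hex
    set a := (dp (dr (dr P))).1 ⟨z, hz⟩ with ha
    set b := (dr (dr (dr P))).1 ⟨z, hz⟩ with hb
    have inv := fun {f : smoothAlg D} (hf : FiberInvariant D (zeroExt f.1)) v =>
      fiberInvariant_dirDeriv hD hf v
    have heq : ∀ v ∈ I, g v ≠ 0 → a * g v + b * z.2 1 * deriv g v = 0 := by
      intro v hv hgv
      have hm : setU z v ∈ D := hmove z hz.1 v hv hgv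
      have e := congrArg (fun f : smoothAlg D => f.1 ⟨setU z v, hm⟩) hcubic
      change (dp (dr (dr P))).1 ⟨setU z v, hm⟩ * g v +
        (dr (dr (dr P))).1 ⟨setU z v, hm⟩ * z.2 1 * deriv g v = 0 at e
      rwa [hconst _ (inv (inv (inv hinvP _) _) _) z hz v hm,
        hconst _ (inv (inv (inv hinvP _) _) _) z hz v hm] at e
    -- If `b = 0`, then `a g(v₀) = 0` forces `a = 0`, against the choice of the jet. Hence `g' = k
    -- g` where `g ≠ 0`, with `k = -a / (b p)`, and `c = k²`.
    have hb0 : b ≠ 0 := by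
      intro h0
      have := heq v₀ hv₀ hgv₀
      rw [h0] at this
      exact hne ⟨by simpa [hgv₀] using this, h0⟩
    have hz1 : z.2 1 ≠ 0 := hz.1.2.1
    refine ⟨(-a / (b * z.2 1)) ^ 2, forall_of_forall_ne_zero hI hg
      (deriv_deriv_of_deriv hI hg fun v hv hgv => ?_)⟩
    have := heq v hv hgv
    field_simp
    linear_combination this

end Necessity
end KleinGordon

end

/-- The hypothesis that `g` is nonlinear is not used: the argument shows that `g'' = c g` for some
constant `c`, and the conservation laws are constructed for every `c`, including `c = 0`. -/
theorem corollary2p3p2 (I : Set ℝ) (hI : IsOpen I) (hI' : I.OrdConnected)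
    (g : ℝ → ℝ) (hg : ContDiffOn ℝ ∞ g I)
    (hnonlinear : ¬ ∃ a b : ℝ, ∀ u ∈ I, g u = a * u + b)
    (hlaw : ∃ V : Set (ℝ × (Fin 2 → ℝ)), IsOpen V ∧
      ∃ Pt Px : ℝ × (Fin 3 → ℝ) → ℝ, KleinGordon.IsConservationLaw g I 2 V Pt Px) :
    ∀ q : ℕ, 1 < q → ∃ Pt Px : ℝ × (Fin (q + 1) → ℝ) → ℝ,
      KleinGordon.IsConservationLaw g I q Set.univ Pt Px := by
  intro q hq
  obtain ⟨V, hV, Pt, Px, hPP⟩ := hlaw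
  obtain ⟨c, hc⟩ := hPP.exists_deriv_deriv_eq hI hI' hg hV
  -- The jet at which the given multiplier is nondegenerate shows that `I` is nonempty, as the order
  -- condition of the new laws requires.
  obtain ⟨_, _, ⟨_, w, hw, _⟩, _⟩ := hPP.order
  exact KleinGordon.exists_isConservationLaw hI ⟨_, hw.1⟩ hg hc hq
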